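/- **Conventions.** A *compact matrix convex set* over a Hausdorff locally convex complex topological vector space $V$ is a family $\mathbf K=(K_n)_{n\ge 1}$ of subsets $K_n\subseteq M_n(V)$, each compact in the product topology, such that $\sum_{i=1}^k\gamma_i^*\mu_i\gamma_i\in K_n$ whenever $\mu_i\in K_{n_i}$ and $\gamma_i\in M_{n_i,n}(\mathbb C)$ satisfy $\sum_{i=1}^k\gamma_i^*\gamma_i=1$. A family of maps $f=(f_n)$ defined on the sets $K_n$ is *matrix affine* if $f_n(\sum_i\gamma_i^*\mu_i\gamma_i)=\sum_i\gamma_i^*f_{n_i}(\mu_i)\gamma_i$ for all such $\mu_i,\gamma_i$. Between compact matrix convex sets, such an $f$ is continuous (surjective) if every $f_n$ is. Let $G$ be a discrete group. A *matrix affine dynamical system* $(\mathbf K,G)$ is a compact matrix convex set $\mathbf K$ with a homomorphism $h$ from $G$ to the group of homeomorphisms of $\mathbf K$ (families of homeomorphisms $K_n\to K_n$) such that each $h_s$ is matrix affine. Given matrix affine dynamical systems $(\mathbf K,G)$ and $(\mathbf L,G)$ and an equivariant continuous surjective matrix affine map $f:\mathbf L\to\mathbf K$, the pair $((\mathbf L,G),f)$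 is a *boundary* for $(\mathbf K,G)$ if every $G$-invariant compact matrix convex subset $\mathbf L'\subseteq\mathbf L$ with $f(\mathbf L')=\mathbf K$ equals $\mathbf L$. $A(\mathbf K)$ denotes the set of all matrix affine $a=(a_n)$, $a_n:K_n\to M_n(\mathbb C)$, with $a_1$ continuous. Such families are uniformly bounded, and $A(\mathbf K)$ is an operator system, i.e. a unital self-adjoint subspace of a unital C*-algebra, namely of the $\ell^\infty$-product $\prod_{n\ge1}\prod_{\mu\in K_n}M_n(\mathbb C)$; the group $G$ acts on it by $(\alpha_s a)(\mu)=a(h_{s^{-1}}(\mu))$. A *noncommutative dynamical system* $(S,G)$ is an operator system $S$ with a homomorphism from $G$ to the group of unital complete order automorphisms of $S$. A *morphism* is an equivariant unital completely positive map, and an *embedding* is a morphism which is a complete order injection. An *extension* $((T,G),\iota)$ of $(S,G)$ is a noncommutative dynamical system $(T,G)$ with an embedding $\iota:S\to T$; it is *essential* if, for every noncommutative dynamical system $(R,G)$, every morphism $\varphi:T\to R$ such that $\varphi\circ\iota$ is an embedding is itself an embedding. **Theorem.** Let $(\mathbf K,G)$ and $(\mathbf L,G)$ be matrix affine dynamical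 systems and let $f:\mathbf L\to\mathbf K$ be an equivariant continuous surjective matrix affine map. Then $((\mathbf L,G),f)$ is a boundary for $(\mathbf K,G)$ if and only if $((A(\mathbf L),G),\iota)$ is an essential extension of $(A(\mathbf K),G)$, where $\iota:A(\mathbf K)\to A(\mathbf L)$ is the map defined by $\iota(a)(\mu)=a(f(\mu))$ for $a\in A(\mathbf K)$ and $\mu\in\mathbf L$. -/

import Mathlib

namespace NCBoundary

universe u v w

/-! ### Matrix convex sets and matrix affine maps -/

section MatrixConvexity

/-- The product `γ* μ γ` in `M_n(V)`, for a scalar matrix `γ ∈ M_{m,n}(ℂ)` and `μ ∈ M_m(V)`. -/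
def sandwich {V : Type*} [AddCommGroup V] [Module ℂ V] {m n : ℕ}
    (γ : Matrix (Fin m) (Fin n) ℂ) (μ : Matrix (Fin m) (Fin m) V) :
    Matrix (Fin n) (Fin n) V :=
  Matrix.of fun i j => ∑ k, ∑ l, (star (γ k i) * γ l j) • μ k l

/-- For `V = ℂ` this is the usual matrix product. -/
theorem sandwich_complex {m n : ℕ} (γ : Matrix (Fin m) (Fin n) ℂ)
    (μ : Matrix (Fin m) (Fin m) ℂ) : sandwich γ μ = γ.conjTranspose * μ * γ := by
  ext i j
  simp only [sandwich, Matrix.of_apply, smul_eq_mul, Matrix.mul_apply, Matrix.conjTranspose_apply,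
    Finset.sum_mul]
  rw [Finset.sum_comm]
  refine Finset.sum_congr rfl fun _ _ => Finset.sum_congr rfl fun _ _ => by ring

/-- The coefficients of a matrix convex combination of size `n`: finitely many scalar matrices
`γ_i ∈ M_{n_i,n}(ℂ)` with `∑ γ_i* γ_i = 1`. -/
structure ConvexCoeffs (n : ℕ+) where
  /-- the number of terms -/
  count : ℕ
  /-- the sizes `n_i ≥ 1` -/
  size : Fin count → ℕ+
  /-- the scalar matrices `γ_i` -/
  coeff : ∀ i, Matrix (Fin (size i)) (Fin n) ℂ
  sum_eq_one : ∑ i, (coeff i).conjTranspose * coeff i = 1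

/-- The matrix convex combination `∑ γ_i* μ_i γ_i`. -/
def ConvexCoeffs.comb {V : Type*} [AddCommGroup V] [Module ℂ V] {n : ℕ+} (c : ConvexCoeffs n)
    (μ : ∀ i, Matrix (Fin (c.size i)) (Fin (c.size i)) V) : Matrix (Fin n) (Fin n) V :=
  ∑ i, sandwich (c.coeff i) (μ i)

/-- A compact matrix convex set `K = (K_n)_{n ≥ 1}` over `V`: each `K_n ⊆ M_n(V)` is compact in the
product topology and the family is closed under matrix convex combinations (in particular each
`K_n` is convex, by taking `γ_i = √t_i • 1`). -/
structure CompactMatrixConvexSet (V : Type*) [AddCommGroup V] [Module ℂ V]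
    [TopologicalSpace V] where
  /-- the set `K_n` -/
  level : ∀ n : ℕ+, Set (Matrix (Fin n) (Fin n) V)
  comb_mem : ∀ (n : ℕ+) (c : ConvexCoeffs n)
    (μ : ∀ i, Matrix (Fin (c.size i)) (Fin (c.size i)) V),
    (∀ i, μ i ∈ level (c.size i)) → c.comb μ ∈ level n
  isCompact_level : ∀ n, IsCompact (level n)

variable {V W : Type*} [AddCommGroup V] [Module ℂ V] [TopologicalSpace V]
  [AddCommGroup W] [Module ℂ W]

/-- A family of maps `f_n : K_n → M_n(W)` is matrix affine if it preserves matrix convex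
combinations. -/
def IsMatrixAffine (K : CompactMatrixConvexSet V)
    (f : ∀ n : ℕ+, K.level n → Matrix (Fin n) (Fin n) W) : Prop :=
  ∀ (n : ℕ+) (c : ConvexCoeffs n) (μ : ∀ i, K.level (c.size i)),
    f n ⟨c.comb fun i => (μ i : Matrix (Fin (c.size i)) (Fin (c.size i)) V),
        K.comb_mem n c _ fun i => (μ i).2⟩ =
      c.comb fun i => f (c.size i) (μ i)

/-- A continuous matrix affine function from `K` to `(M_n(ℂ))_{n ≥ 1}`; continuity means that
`a_1` is continuous. -/
structure IsAffineFunction (K : CompactMatrixConvexSet V)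
    (a : ∀ n : ℕ+, K.level n → Matrix (Fin n) (Fin n) ℂ) : Prop where
  affine : IsMatrixAffine K a
  continuous_one : Continuous (a 1)

/-- A continuous matrix affine map `f = (f_n) : L → K` of compact matrix convex sets. -/
structure ContMatrixAffineMap {V W : Type*} [AddCommGroup V] [Module ℂ V] [TopologicalSpace V]
    [AddCommGroup W] [Module ℂ W] [TopologicalSpace W]
    (L : CompactMatrixConvexSet V) (K : CompactMatrixConvexSet W) where
  /-- the maps `f_n` -/
  toFun : ∀ n : ℕ+, L.level n → K.level n
  continuous_toFun : ∀ n, Continuous (toFun n)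
  affine : IsMatrixAffine L fun n μ => (toFun n μ : Matrix (Fin n) (Fin n) W)

/-- A matrix affine dynamical system `(K, G, h)`: a homomorphism `h` from the discrete group `G` to
the group of homeomorphisms of `K = (K_n)`, with each `h_s` matrix affine. -/
structure MatrixAffineSystem (G : Type*) [Group G] (V : Type*) [AddCommGroup V] [Module ℂ V]
    [TopologicalSpace V] extends CompactMatrixConvexSet V where
  /-- the action `h` -/
  act : G →* (∀ n : ℕ+, level n ≃ₜ level n)
  act_affine : ∀ s, IsMatrixAffine toCompactMatrixConvexSet
    fun n μ => (act s n μ : Matrix (Fin n) (Fin n) V)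

/-- The action of `s` as a continuous matrix affine self-map. -/
def MatrixAffineSystem.actMap {G : Type*} [Group G] (K : MatrixAffineSystem G V) (s : G) :
    ContMatrixAffineMap K.toCompactMatrixConvexSet K.toCompactMatrixConvexSet where
  toFun n := K.act s n
  continuous_toFun n := (K.act s n).continuous
  affine := K.act_affine s

end MatrixConvexity

/-! ### Boundaries -/

section Boundary

variable {G : Type*} [Group G] {V W : Type*} [AddCommGroup V] [Module ℂ V] [TopologicalSpace V]
  [AddCommGroup W] [Module ℂ W] [TopologicalSpace W]

/-- Equivariance of `f : L → K`. -/
def IsEquivariant (L : MatrixAffineSystem G V) (K : MatrixAffineSystem G W)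
    (f : ContMatrixAffineMap L.toCompactMatrixConvexSet K.toCompactMatrixConvexSet) : Prop :=
  ∀ (s : G) (n : ℕ+) (μ : L.level n), f.toFun n (L.act s n μ) = K.act s n (f.toFun n μ)

/-- `((L, G), f)` is a boundary for `(K, G)`: `f` is surjective (at every level), and every
invariant compact matrix convex `L' ⊆ L` with `f(L') = K` equals `L`. -/
structure IsBoundary (L : MatrixAffineSystem G V) (K : MatrixAffineSystem G W)
    (f : ContMatrixAffineMap L.toCompactMatrixConvexSet K.toCompactMatrixConvexSet) : Prop where
  surjective : ∀ n, Function.Surjective (f.toFun n)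
  minimal : ∀ L' : CompactMatrixConvexSet V,
    (∀ n, L'.level n ⊆ L.level n) →
    (∀ (s : G) (n : ℕ+) (μ : L.level n), (μ : Matrix (Fin n) (Fin n) V) ∈ L'.level n →
      (L.act s n μ : Matrix (Fin n) (Fin n) V) ∈ L'.level n) →
    (∀ (n : ℕ+) (ν : K.level n), ∃ μ : L.level n,
      (μ : Matrix (Fin n) (Fin n) V) ∈ L'.level n ∧ f.toFun n μ = ν) →
    ∀ n, L'.level n = L.level n

end Boundary

/-! ### Operator systems and noncommutative dynamical systems -/

section OperatorSystems

/-- An operator system: a unital self-adjoint subspace of a (unital) C*-algebra. -/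
structure OperatorSystem where
  /-- the ambient C*-algebra -/
  ambient : Type u
  [cstar : CStarAlgebra ambient]
  /-- the underlying subspace -/
  carrier : Submodule ℂ ambient
  one_mem : (1 : ambient) ∈ carrier
  star_mem : ∀ x ∈ carrier, star x ∈ carrier

attribute [instance] OperatorSystem.cstar

/-- The unit of an operator system. -/
def OperatorSystem.unit (S : OperatorSystem.{u}) : S.carrier := ⟨1, S.one_mem⟩

/-- Positivity of a matrix over an operator system `S ⊆ B`, i.e. positivity in the C*-algebra
`M_n(B)`. -/
def OperatorSystem.IsPositive (S : OperatorSystem.{u}) {n : ℕ}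
    (a : Matrix (Fin n) (Fin n) S.carrier) : Prop :=
  ∃ b : Matrix (Fin n) (Fin n) S.ambient,
    a.map (fun x => (x : S.ambient)) = b.conjTranspose * b

/-- Unital completely positive maps of operator systems. -/
structure IsUCP (S : OperatorSystem.{u}) (T : OperatorSystem.{v})
    (φ : S.carrier →ₗ[ℂ] T.carrier) : Prop where
  map_unit : φ S.unit = T.unit
  map_positive : ∀ (n : ℕ) (a : Matrix (Fin n) (Fin n) S.carrier),
    S.IsPositive a → T.IsPositive (a.map φ)

/-- A noncommutative dynamical system `(S, G, α)`: a homomorphism `α` from the discrete group `G`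
to the group of (unital) complete order automorphisms of the operator system `S`. -/
structure NCDynSystem (G : Type*) [Group G] extends OperatorSystem.{u} where
  /-- the action `α` -/
  act : G →* (carrier ≃ₗ[ℂ] carrier)
  act_ucp : ∀ s, IsUCP toOperatorSystem toOperatorSystem (act s : carrier →ₗ[ℂ] carrier)
  act_symm_ucp : ∀ s,
    IsUCP toOperatorSystem toOperatorSystem ((act s).symm : carrier →ₗ[ℂ] carrier)

variable {G : Type*} [Group G]

/-- Morphisms of noncommutative dynamical systems: equivariant unital completely positive maps. -/
structure IsMorphism (S : NCDynSystem.{u} G) (T : NCDynSystem.{v} G)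
    (φ : S.carrier →ₗ[ℂ] T.carrier) : Prop where
  ucp : IsUCP S.toOperatorSystem T.toOperatorSystem φ
  equivariant : ∀ (s : G) (x : S.carrier), φ (S.act s x) = T.act s (φ x)

/-- Embeddings: morphisms that are complete order injections. -/
structure IsEmbedding (S : NCDynSystem.{u} G) (T : NCDynSystem.{v} G)
    (φ : S.carrier →ₗ[ℂ] T.carrier) : Prop where
  morphism : IsMorphism S T φ
  injective : Function.Injective φ
  reflects_positive : ∀ (n : ℕ) (a : Matrix (Fin n) (Fin n) S.carrier),
    T.IsPositive (a.map φ) → S.IsPositive a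

/-- `((T, G), ι)` is an essential extension of `(S, G)`: `ι : S → T` is an embedding, and every
morphism `φ : T → R` for which `φ ∘ ι` is an embedding is itself an embedding. (It is enough to let
`R` range over the universe of `T`: one may replace `R` by the range of `φ` inside the C*-algebra
that this range generates.) -/
structure IsEssentialExtension (S : NCDynSystem.{u} G) (T : NCDynSystem.{v} G)
    (ι : S.carrier →ₗ[ℂ] T.carrier) : Prop where
  embedding : IsEmbedding S T ι
  essential : ∀ (R : NCDynSystem.{v} G) (φ : T.carrier →ₗ[ℂ] R.carrier),
    IsMorphism T R φ → IsEmbedding S R (φ ∘ₗ ι) → IsEmbedding T R φ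

end OperatorSystems

/-! ### The operator system `A(K)` -/

section AffineFunctions

open scoped Matrix.Norms.L2Operator ENNReal InnerProductSpace

section Bounded

variable {V : Type*} [AddCommGroup V] [Module ℂ V] [TopologicalSpace V]

/-- The one-term matrix convex combination given by a unit column vector. -/
noncomputable def ConvexCoeffs.ofUnitVector {n : ℕ+} (x : EuclideanSpace ℂ (Fin n))
    (hx : ‖x‖ = 1) : ConvexCoeffs 1 where
  count := 1
  size _ := n
  coeff _ := Matrix.of fun i _ => x i
  sum_eq_one := by
    have h := EuclideanSpace.norm_sq_eq x
    rw [hx] at h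
    ext i j
    have hij : i = j := Subsingleton.elim (α := Fin 1) i j
    subst hij
    simp only [Finset.univ_unique, Finset.sum_singleton, Matrix.mul_apply,
      Matrix.conjTranspose_apply, Matrix.of_apply, Matrix.one_apply_eq]
    have : ∀ k, star (x k) * x k = ((‖x k‖ ^ 2 : ℝ) : ℂ) := fun k => by
      rw [mul_comm, Complex.star_def, Complex.mul_conj, Complex.normSq_eq_norm_sq]
    simp only [this]
    rw [← Complex.ofReal_sum, ← h]
    simp

/-- Continuous matrix affine functions on a compact matrix convex set are uniformly bounded in the
operator norms of the `M_n(ℂ)`. -/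
theorem IsAffineFunction.bounded {K : CompactMatrixConvexSet V}
    {a : ∀ n : ℕ+, K.level n → Matrix (Fin n) (Fin n) ℂ} (ha : IsAffineFunction K a) :
    ∃ C : ℝ, ∀ (n : ℕ+) (μ : K.level n), ‖a n μ‖ ≤ C := by
  have : CompactSpace (K.level 1) := isCompact_iff_compactSpace.1 (K.isCompact_level 1)
  have hc : Continuous fun μ : K.level 1 => a 1 μ 0 0 :=
    (continuous_apply _).comp ((continuous_apply _).comp ha.continuous_one)
  obtain ⟨C, hC⟩ := (isCompact_range hc).isBounded.exists_norm_le
  have hC0 : 0 ≤ max C 0 := le_max_right _ _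
  refine ⟨2 * max C 0, fun n μ => ?_⟩
  set T := Matrix.toEuclideanCLM (n := Fin n) (𝕜 := ℂ) (a n μ) with hT
  have unit : ∀ x : EuclideanSpace ℂ (Fin n), ‖x‖ = 1 → ‖⟪x, T x⟫_ℂ‖ ≤ max C 0 := by
    intro x hx
    have h1 := ha.affine 1 (ConvexCoeffs.ofUnitVector x hx) (fun _ => μ)
    have h2 : ⟪x, T x⟫_ℂ = a 1 ⟨(ConvexCoeffs.ofUnitVector x hx).comb fun _ => μ.1,
        K.comb_mem 1 _ _ fun _ => μ.2⟩ 0 0 := by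
      rw [h1]
      have h3 : (ConvexCoeffs.ofUnitVector x hx).comb (fun _ => a n μ) =
          sandwich (Matrix.of fun i (_ : Fin 1) => x i) (a n μ) :=
        Fin.sum_univ_one fun _ : Fin 1 => sandwich (Matrix.of fun i (_ : Fin 1) => x i) (a n μ)
      refine Eq.trans ?_ (congrFun (congrFun h3 0) 0).symm
      simp only [sandwich, Matrix.of_apply, smul_eq_mul, PiLp.inner_apply, hT,
        Matrix.ofLp_toEuclideanCLM, Matrix.mulVec, dotProduct, RCLike.inner_apply, Finset.sum_mul]
      refine Finset.sum_congr rfl fun _ _ => Finset.sum_congr rfl fun _ _ => ?_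
      simp only [Complex.star_def]
      ring
    rw [h2]
    exact (hC _ ⟨_, rfl⟩).trans (le_max_left _ _)
  have quad : ∀ x : EuclideanSpace ℂ (Fin n), ‖⟪T x, x⟫_ℂ‖ ≤ max C 0 * ‖x‖ ^ 2 := by
    intro x
    by_cases hx : x = 0
    · simp [hx]
    have hx' : ‖x‖ ≠ 0 := norm_ne_zero_iff.2 hx
    have hu := unit ((‖x‖⁻¹ : ℂ) • x) (by simp [norm_smul, hx'])
    rw [map_smul, inner_smul_left, inner_smul_right, norm_mul, norm_mul] at hu
    have e : ‖⟪x, T x⟫_ℂ‖ = ‖⟪T x, x⟫_ℂ‖ := norm_inner_symm _ _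
    rw [e] at hu
    simp only [map_inv₀, Complex.conj_ofReal, norm_inv, Complex.norm_real, norm_norm] at hu
    have hp : 0 < ‖x‖ := norm_pos_iff.2 hx
    calc ‖⟪T x, x⟫_ℂ‖ = (‖x‖⁻¹ * (‖x‖⁻¹ * ‖⟪T x, x⟫_ℂ‖)) * ‖x‖ ^ 2 := by field_simp
      _ ≤ _ := by gcongr
  rw [← Matrix.l2_opNorm_toEuclideanCLM, ← hT]
  refine ContinuousLinearMap.opNorm_le_of_re_inner_le (by positivity) fun x y hx hy => ?_
  refine (RCLike.re_le_norm _).trans ?_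
  have key := inner_map_polarization' (T : EuclideanSpace ℂ (Fin n) →ₗ[ℂ] _) x y
  simp only [ContinuousLinearMap.coe_coe] at key
  rw [key]
  have p1 := parallelogram_law_with_norm ℂ x y
  have p2 := parallelogram_law_with_norm ℂ x (Complex.I • y)
  have hI : ‖Complex.I • y‖ = 1 := by simp [norm_smul, hy]
  rw [hx, hy] at p1
  rw [hx, hI] at p2
  have q1 := quad (x + y)
  have q2 := quad (x - y)
  have q3 := quad (x + Complex.I • y)
  have q4 := quad (x - Complex.I • y)
  rw [norm_div]
  have n4 : ‖(4 : ℂ)‖ = 4 := by norm_num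
  rw [n4, div_le_iff₀ (by norm_num)]
  refine (norm_add_le _ _).trans ?_
  refine (add_le_add_left (norm_sub_le _ _) _).trans ?_
  refine (add_le_add_left (add_le_add_left (norm_sub_le _ _) _) _).trans ?_
  rw [norm_mul, norm_mul, Complex.norm_I, one_mul, one_mul]
  nlinarith

variable {n : ℕ+} (c : ConvexCoeffs n)

theorem ConvexCoeffs.comb_add (μ ν : ∀ i, Matrix (Fin (c.size i)) (Fin (c.size i)) ℂ) :
    c.comb (fun i => μ i + ν i) = c.comb μ + c.comb ν := by
  simp only [ConvexCoeffs.comb, sandwich_complex, Matrix.mul_add, Matrix.add_mul, Finset.sum_add_distrib]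

theorem ConvexCoeffs.comb_smul (z : ℂ) (μ : ∀ i, Matrix (Fin (c.size i)) (Fin (c.size i)) ℂ) :
    c.comb (fun i => z • μ i) = z • c.comb μ := by
  simp only [ConvexCoeffs.comb, sandwich_complex, Matrix.mul_smul, Matrix.smul_mul,
    Finset.smul_sum]

theorem ConvexCoeffs.comb_zero :
    c.comb (fun i => (0 : Matrix (Fin (c.size i)) (Fin (c.size i)) ℂ)) = 0 := by
  simp [ConvexCoeffs.comb, sandwich_complex]

theorem ConvexCoeffs.comb_one :
    c.comb (fun i => (1 : Matrix (Fin (c.size i)) (Fin (c.size i)) ℂ)) = 1 := by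
  simp only [ConvexCoeffs.comb, sandwich_complex, Matrix.mul_one, c.sum_eq_one]

theorem ConvexCoeffs.comb_star (μ : ∀ i, Matrix (Fin (c.size i)) (Fin (c.size i)) ℂ) :
    c.comb (fun i => star (μ i)) = star (c.comb μ) := by
  simp only [ConvexCoeffs.comb, sandwich_complex, star_sum, Matrix.star_eq_conjTranspose,
    Matrix.conjTranspose_mul, Matrix.conjTranspose_conjTranspose, Matrix.mul_assoc]

end Bounded

variable {V : Type v} [AddCommGroup V] [Module ℂ V] [TopologicalSpace V]
  {W : Type w} [AddCommGroup W] [Module ℂ W] [TopologicalSpace W]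

/-- The C*-algebra of bounded families `(a_n : K_n → M_n(ℂ))_{n ≥ 1}`, i.e. the `ℓ^∞`-product of
one copy of `M_n(ℂ)` for each point of each `K_n`. -/
abbrev BoundedFamilies (K : CompactMatrixConvexSet V) : Type v :=
  lp (fun p : (Σ n : ℕ+, K.level n) => Matrix (Fin p.1) (Fin p.1) ℂ) ∞

noncomputable instance (K : CompactMatrixConvexSet V) : CStarAlgebra (BoundedFamilies K) where

/-- The space `A(K)` of continuous matrix affine functions on `K`, inside the C*-algebra of all
bounded families. -/
def affineFunctionSpace (K : CompactMatrixConvexSet V) : Submodule ℂ (BoundedFamilies K) where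
  carrier := {a | IsAffineFunction K fun n μ => a ⟨n, μ⟩}
  add_mem' := fun {a b} ha hb =>
    ⟨fun n c μ => by
      have h1 := ha.affine n c μ
      have h2 := hb.affine n c μ
      simp only [lp.coeFn_add, Pi.add_apply] at h1 h2 ⊢
      rw [h1, h2, c.comb_add], ha.continuous_one.add hb.continuous_one⟩
  zero_mem' := ⟨fun n c μ => (c.comb_zero).symm,
    (continuous_const : Continuous fun _ : K.level 1 => (0 : Matrix (Fin 1) (Fin 1) ℂ))⟩
  smul_mem' := fun z a ha =>
    ⟨fun n c μ => by
      have h1 := ha.affine n c μ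
      simp only [lp.coeFn_smul, Pi.smul_apply] at h1 ⊢
      rw [h1, c.comb_smul], ha.continuous_one.const_smul z⟩

theorem mem_affineFunctionSpace {K : CompactMatrixConvexSet V} {a : BoundedFamilies K} :
    a ∈ affineFunctionSpace K ↔ IsAffineFunction K fun n μ => a ⟨n, μ⟩ :=
  Iff.rfl

/-- Boundedness is automatic: every continuous matrix affine function on `K` is an element of
`A(K)`. -/
theorem exists_mem_affineFunctionSpace (K : CompactMatrixConvexSet V)
    (a : ∀ n : ℕ+, K.level n → Matrix (Fin n) (Fin n) ℂ) (ha : IsAffineFunction K a) :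
    ∃ x ∈ affineFunctionSpace K, ∀ n μ, x ⟨n, μ⟩ = a n μ := by
  obtain ⟨C, hC⟩ := ha.bounded
  exact ⟨⟨fun p => a p.1 p.2, memℓp_infty ⟨C, by rintro _ ⟨p, rfl⟩; exact hC p.1 p.2⟩⟩,
    mem_affineFunctionSpace.2 ha,
    fun _ _ => rfl⟩

/-- The operator system `A(K)`. -/
noncomputable def affineFunctions (K : CompactMatrixConvexSet V) : OperatorSystem.{v} where
  ambient := BoundedFamilies K
  carrier := affineFunctionSpace K
  one_mem := mem_affineFunctionSpace.2 ⟨fun n c μ => (c.comb_one).symm,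
    (continuous_const : Continuous fun _ : K.level 1 => (1 : Matrix (Fin 1) (Fin 1) ℂ))⟩
  star_mem := fun a ha => mem_affineFunctionSpace.2
    ⟨fun n c μ => by
      have h1 := ha.affine n c μ
      simp only [lp.coeFn_star, Pi.star_apply] at h1 ⊢
      rw [h1, c.comb_star], ha.continuous_one.star⟩

/-- Composition of a bounded family on `K` with a family of maps `f_n : L_n → K_n`. -/
def BoundedFamilies.comp {L : CompactMatrixConvexSet V} {K : CompactMatrixConvexSet W}
    (f : ∀ n : ℕ+, L.level n → K.level n) (a : BoundedFamilies K) : BoundedFamilies L :=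
  ⟨fun p => a ⟨p.1, f p.1 p.2⟩, memℓp_infty (by
    obtain ⟨C, hC⟩ := (lp.memℓp a).bddAbove
    exact ⟨C, by rintro _ ⟨p, rfl⟩; exact hC ⟨⟨p.1, f p.1 p.2⟩, rfl⟩⟩)⟩

/-- The map `A(K) → A(L)`, `a ↦ a ∘ f`, induced by a continuous matrix affine map `f : L → K`. -/
def ContMatrixAffineMap.pullback {L : CompactMatrixConvexSet V} {K : CompactMatrixConvexSet W}
    (f : ContMatrixAffineMap L K) : affineFunctionSpace K →ₗ[ℂ] affineFunctionSpace L where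
  toFun a := ⟨BoundedFamilies.comp f.toFun a.1, mem_affineFunctionSpace.2
    ⟨fun n c μ => by
      have h := a.2.affine n c fun i => f.toFun _ (μ i)
      have e : f.toFun n ⟨c.comb fun i => (μ i : Matrix (Fin (c.size i)) (Fin (c.size i)) V),
          L.comb_mem n c _ fun i => (μ i).2⟩ = ⟨c.comb fun i =>
            (f.toFun _ (μ i) : Matrix (Fin (c.size i)) (Fin (c.size i)) W),
          K.comb_mem n c _ fun i => (f.toFun _ (μ i)).2⟩ := Subtype.ext (f.affine n c μ)
      change a.1 ⟨n, f.toFun n _⟩ = _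
      rw [e]
      exact h,
      a.2.continuous_one.comp (f.continuous_toFun 1)⟩⟩
  map_add' _ _ := rfl
  map_smul' _ _ := rfl

/-- The defining formula `(a ∘ f)(μ) = a(f(μ))`. -/
theorem ContMatrixAffineMap.pullback_apply {L : CompactMatrixConvexSet V}
    {K : CompactMatrixConvexSet W} (f : ContMatrixAffineMap L K) (a : affineFunctionSpace K)
    (n : ℕ+) (μ : L.level n) :
    (f.pullback a : BoundedFamilies L) ⟨n, μ⟩ = (a : BoundedFamilies K) ⟨n, f.toFun n μ⟩ :=
  rfl

/-- The induced map `A(K) → A(L)` is unital completely positive. -/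
theorem ContMatrixAffineMap.pullback_ucp {L : CompactMatrixConvexSet V}
    {K : CompactMatrixConvexSet W} (f : ContMatrixAffineMap L K) :
    IsUCP (affineFunctions K) (affineFunctions L) f.pullback where
  map_unit := rfl
  map_positive := by
    rintro n a ⟨b, hb⟩
    have key : ∀ (x : BoundedFamilies K) (y z : Fin n → BoundedFamilies K),
        x = ∑ k, star (y k) * z k → BoundedFamilies.comp f.toFun x =
          ∑ k, star (BoundedFamilies.comp f.toFun (y k)) * BoundedFamilies.comp f.toFun (z k) := by
      rintro x y z rfl
      apply lp.ext
      funext p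
      simp only [BoundedFamilies.comp, lp.coeFn_sum, Finset.sum_apply, lp.infty_coeFn_mul,
        Pi.mul_apply, lp.coeFn_star, Pi.star_apply]
    refine ⟨fun i j => BoundedFamilies.comp f.toFun (b i j), ?_⟩
    ext i j : 2
    exact key _ _ _ (congrFun (congrFun hb i) j)

theorem MatrixAffineSystem.pullback_actMap_one {G : Type*} [Group G]
    (K : MatrixAffineSystem G V) : (K.actMap 1).pullback = LinearMap.id := by
  apply LinearMap.ext
  intro a
  apply Subtype.ext
  apply lp.ext
  funext p
  change (a : BoundedFamilies K.toCompactMatrixConvexSet) ⟨p.1, K.act 1 p.1 p.2⟩ = a.1 p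
  rw [map_one]
  rfl

theorem MatrixAffineSystem.pullback_actMap_comp {G : Type*} [Group G]
    (K : MatrixAffineSystem G V) (s t : G) :
    (K.actMap t).pullback ∘ₗ (K.actMap s).pullback = (K.actMap (s * t)).pullback := by
  apply LinearMap.ext
  intro a
  apply Subtype.ext
  apply lp.ext
  funext p
  change (a : BoundedFamilies K.toCompactMatrixConvexSet) ⟨p.1, K.act s p.1 (K.act t p.1 p.2)⟩ =
    (a : BoundedFamilies K.toCompactMatrixConvexSet) ⟨p.1, K.act (s * t) p.1 p.2⟩
  rw [map_mul]
  rfl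

/-- The linear automorphism `a ↦ a ∘ h_{s⁻¹}` of `A(K)`. -/
noncomputable def MatrixAffineSystem.actEquiv {G : Type*} [Group G] (K : MatrixAffineSystem G V) (s : G) :
    affineFunctionSpace K.toCompactMatrixConvexSet ≃ₗ[ℂ]
      affineFunctionSpace K.toCompactMatrixConvexSet :=
  LinearEquiv.ofLinearMap (K.actMap s⁻¹).pullback (K.actMap s).pullback
    (by rw [K.pullback_actMap_comp, mul_inv_cancel, K.pullback_actMap_one])
    (by rw [K.pullback_actMap_comp, inv_mul_cancel, K.pullback_actMap_one])

/-- The noncommutative dynamical system `(A(K), G)` of a matrix affine dynamical system `(K, G, h)`,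
with action `α_s(a) = a ∘ h_{s⁻¹}`. -/
noncomputable def affineFunctionSystem {G : Type*} [Group G] (K : MatrixAffineSystem G V) :
    NCDynSystem.{v} G where
  toOperatorSystem := affineFunctions K.toCompactMatrixConvexSet
  act :=
    { toFun := K.actEquiv
      map_one' := by
        apply LinearEquiv.toLinearMap_injective
        change (K.actMap 1⁻¹).pullback = LinearMap.id
        rw [inv_one, K.pullback_actMap_one]
      map_mul' := fun s t => by
        apply LinearEquiv.toLinearMap_injective
        change (K.actMap (s * t)⁻¹).pullback = (K.actMap s⁻¹).pullback ∘ₗ (K.actMap t⁻¹).pullback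
        rw [K.pullback_actMap_comp, mul_inv_rev] }
  act_ucp s := (K.actMap s⁻¹).pullback_ucp
  act_symm_ucp s := (K.actMap s).pullback_ucp

/-- The action is given by `(α_s a)(μ) = a(h_{s⁻¹}(μ))`. -/
theorem affineFunctionSystem_act_apply {G : Type*} [Group G] (K : MatrixAffineSystem G V) (s : G)
    (a : affineFunctionSpace K.toCompactMatrixConvexSet) :
    (affineFunctionSystem K).act s a = (K.actMap s⁻¹).pullback a :=
  rfl

end AffineFunctions

end NCBoundary

/-! Positivity over `A(K)` is pointwise positivity on `K` (`isPositive_affineFunctions_iff`). Both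
directions then rest on one separation theorem, `exists_separating_affineFunction`. Let `s` be a
finite set of matrices `a ∈ M_n(A(L))`, and let `ν ∈ K_n` be such that over `ν` there is no `μ ∈
L_n` at which all forms `pairing 1 (a(μ))` are nonnegative. Then some `b ∈ M_n(A(K))` and scalars
`t_a ≥ 0` satisfy `b ∘ f ≥ ∑ t_a a` on `L`, in the sense of real parts of quadratic forms, while `b`
is negative at `ν`.

This is Hahn–Banach applied to the triples `(γ* f(μ) γ, γ* γ, (pairing γ (a(μ)))_a)` with `γ* γ` of
trace `n`. They form a compact set, which is convex because a sum of compressions is again a single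
compression, by polar decomposition. A triple starting with `(ν, 1)` comes from a unitary `γ`, hence
from the point `γ* μ γ` over `ν`, so one of its last entries is negative.

Boundary implies essential: let `φ` be a morphism on `A(L)` that is an embedding on `A(K)`. The
points of `L` at which every matrix with positive image under `φ` is positive form an invariant
compact matrix convex set. It maps onto `K`: otherwise compactness of the fibre yields a finite `s`
and then `b` as above, but `φ(b ∘ f)` dominates `∑ t_a φ(a) ≥ 0` up to real parts, so `b` would be
positive. Minimality makes this set all of `L`, which says that `φ` reflects positivity and is
injective.

Essential implies boundary: if `L' ⊆ L` is invariant with `f(L') = K`, restriction `A(L) → A(L')` is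
a morphism that is an embedding on `A(K)`, hence an embedding. A point of `L` outside `L'` would be
separated from `L'` by the same theorem with `s` empty, contradicting this. -/

namespace NCBoundary

/-! ### Algebra of the products `γ* μ γ` -/

section Sandwich

variable {V : Type*} [AddCommGroup V] [Module ℂ V] {m n r : ℕ}

theorem sandwich_apply (γ : Matrix (Fin m) (Fin n) ℂ) (μ : Matrix (Fin m) (Fin m) V) (i j : Fin n) :
    sandwich γ μ i j = ∑ k, ∑ l, (star (γ k i) * γ l j) • μ k l := rfl

theorem sandwich_sandwich (γ : Matrix (Fin m) (Fin n) ℂ) (δ : Matrix (Fin n) (Fin r) ℂ)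
    (μ : Matrix (Fin m) (Fin m) V) : sandwich δ (sandwich γ μ) = sandwich (γ * δ) μ := by
  ext i j
  simp only [sandwich_apply, Matrix.mul_apply, Finset.smul_sum, smul_smul, star_sum,
    Finset.sum_mul, Finset.mul_sum, Finset.sum_smul, star_mul']
  calc
    _ = ∑ k, ∑ p, ∑ l, ∑ q, (star (δ k i) * δ l j * (star (γ p k) * γ q l)) • μ p q :=
      Finset.sum_congr rfl fun _ _ => Finset.sum_comm
    _ = ∑ p, ∑ k, ∑ l, ∑ q, (star (δ k i) * δ l j * (star (γ p k) * γ q l)) • μ p q :=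
      Finset.sum_comm
    _ = ∑ p, ∑ k, ∑ q, ∑ l, (star (δ k i) * δ l j * (star (γ p k) * γ q l)) • μ p q :=
      Finset.sum_congr rfl fun _ _ => Finset.sum_congr rfl fun _ _ => Finset.sum_comm
    _ = ∑ p, ∑ q, ∑ k, ∑ l, (star (δ k i) * δ l j * (star (γ p k) * γ q l)) • μ p q :=
      Finset.sum_congr rfl fun _ _ => Finset.sum_comm
    _ = _ := by
      refine Finset.sum_congr rfl fun p _ => Finset.sum_congr rfl fun q _ => ?_
      rw [Finset.sum_comm]
      refine Finset.sum_congr rfl fun _ _ => Finset.sum_congr rfl fun _ _ => ?_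
      congr 1
      ring

theorem sandwich_one (μ : Matrix (Fin n) (Fin n) V) : sandwich 1 μ = μ := by
  ext i j
  simp only [sandwich_apply, Matrix.one_apply]
  rw [Finset.sum_eq_single i (fun b _ hb => by simp [hb]) (by simp),
    Finset.sum_eq_single j (fun b _ hb => by simp [hb]) (by simp)]
  simp

/-- `μ ↦ γ* μ γ` as a linear map. -/
def sandwichHom (γ : Matrix (Fin m) (Fin n) ℂ) :
    Matrix (Fin m) (Fin m) V →ₗ[ℂ] Matrix (Fin n) (Fin n) V where
  toFun := sandwich γ
  map_add' μ ν := by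
    ext i j
    simp only [sandwich_apply, Matrix.add_apply, smul_add, Finset.sum_add_distrib]
  map_smul' z μ := by
    ext i j
    simp only [sandwich_apply, Matrix.smul_apply, RingHom.id_apply, Finset.smul_sum,
      smul_comm z (_ : ℂ) (_ : V)]

theorem sandwich_add (γ : Matrix (Fin m) (Fin n) ℂ) (μ ν : Matrix (Fin m) (Fin m) V) :
    sandwich γ (μ + ν) = sandwich γ μ + sandwich γ ν :=
  (sandwichHom γ).map_add μ ν

theorem sandwich_smul (γ : Matrix (Fin m) (Fin n) ℂ) (z : ℂ) (μ : Matrix (Fin m) (Fin m) V) :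
    sandwich γ (z • μ) = z • sandwich γ μ :=
  (sandwichHom γ).map_smul z μ

theorem sandwich_sum {ι : Type*} [Fintype ι] (γ : Matrix (Fin m) (Fin n) ℂ)
    (μ : ι → Matrix (Fin m) (Fin m) V) : sandwich γ (∑ i, μ i) = ∑ i, sandwich γ (μ i) :=
  map_sum (sandwichHom γ) μ _

theorem sandwich_real_smul_left (γ : Matrix (Fin m) (Fin n) ℂ) (t : ℝ)
    (μ : Matrix (Fin m) (Fin m) V) :
    sandwich ((t : ℂ) • γ) μ = ((t ^ 2 : ℝ) : ℂ) • sandwich γ μ := by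
  ext i j
  simp only [sandwich_apply, Matrix.smul_apply, Finset.smul_sum, smul_smul, smul_eq_mul, star_mul']
  refine Finset.sum_congr rfl fun _ _ => Finset.sum_congr rfl fun _ _ => ?_
  congr 1
  simp only [Complex.star_def, Complex.conj_ofReal, Complex.ofReal_pow]
  ring

theorem sandwich_map {W : Type*} [AddCommGroup W] [Module ℂ W] (φ : V →ₗ[ℂ] W)
    (γ : Matrix (Fin m) (Fin n) ℂ) (μ : Matrix (Fin m) (Fin m) V) :
    (sandwich γ μ).map φ = sandwich γ (μ.map φ) := by
  ext i j
  simp only [sandwich_apply, Matrix.map_apply, map_sum, map_smul]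

theorem continuous_sandwich [TopologicalSpace V] [ContinuousAdd V] [ContinuousSMul ℂ V] :
    Continuous fun p : Matrix (Fin m) (Fin n) ℂ × Matrix (Fin m) (Fin m) V =>
      sandwich p.1 p.2 := by
  refine continuous_matrix fun i j => ?_
  simp only [sandwich_apply]
  refine continuous_finsetSum _ fun k _ => continuous_finsetSum _ fun l _ => ?_
  have h1 : ∀ (k : Fin m) (i : Fin n), Continuous
      fun p : Matrix (Fin m) (Fin n) ℂ × Matrix (Fin m) (Fin m) V => p.1 k i :=
    fun k i => continuous_fst.matrix_elem k i
  exact ((h1 k i).star.mul (h1 l j)).smul (continuous_snd.matrix_elem k l)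

end Sandwich

/-! ### Matrix convex combinations over finite index types -/

section Combinations

variable {V W : Type*} [AddCommGroup V] [Module ℂ V] [TopologicalSpace V]
  [AddCommGroup W] [Module ℂ W] {n : ℕ+} {ι : Type*} [Fintype ι]

/-- The convex coefficients given by a family indexed by an arbitrary finite type. -/
noncomputable def ConvexCoeffs.ofFintype (size : ι → ℕ+)
    (coeff : ∀ i, Matrix (Fin (size i)) (Fin n) ℂ)
    (h : ∑ i, (coeff i).conjTranspose * coeff i = 1) : ConvexCoeffs n where
  count := Fintype.card ι
  size i := size ((Fintype.equivFin ι).symm i)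
  coeff i := coeff ((Fintype.equivFin ι).symm i)
  sum_eq_one := by
    rw [← h]
    exact (Fintype.equivFin ι).symm.sum_comp fun i => (coeff i).conjTranspose * coeff i

theorem ConvexCoeffs.comb_ofFintype {V : Type*} [AddCommGroup V] [Module ℂ V] (size : ι → ℕ+)
    (coeff : ∀ i, Matrix (Fin (size i)) (Fin n) ℂ)
    (h : ∑ i, (coeff i).conjTranspose * coeff i = 1)
    (μ : ∀ i, Matrix (Fin (size i)) (Fin (size i)) V) :
    (ConvexCoeffs.ofFintype size coeff h).comb (fun i => μ ((Fintype.equivFin ι).symm i)) =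
      ∑ i, sandwich (coeff i) (μ i) :=
  (Fintype.equivFin ι).symm.sum_comp fun i => sandwich (coeff i) (μ i)

theorem CompactMatrixConvexSet.sum_sandwich_mem (L : CompactMatrixConvexSet V) (size : ι → ℕ+)
    (coeff : ∀ i, Matrix (Fin (size i)) (Fin n) ℂ)
    (h : ∑ i, (coeff i).conjTranspose * coeff i = 1) (μ : ∀ i, L.level (size i)) :
    ∑ i, sandwich (coeff i) (μ i : Matrix (Fin (size i)) (Fin (size i)) V) ∈ L.level n := by
  rw [← ConvexCoeffs.comb_ofFintype size coeff h]
  exact L.comb_mem n _ _ fun i => (μ _).2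

theorem IsMatrixAffine.map_sum_sandwich {L : CompactMatrixConvexSet V}
    {f : ∀ n : ℕ+, L.level n → Matrix (Fin n) (Fin n) W} (hf : IsMatrixAffine L f)
    (size : ι → ℕ+) (coeff : ∀ i, Matrix (Fin (size i)) (Fin n) ℂ)
    (h : ∑ i, (coeff i).conjTranspose * coeff i = 1) (μ : ∀ i, L.level (size i)) :
    f n ⟨_, L.sum_sandwich_mem size coeff h μ⟩ = ∑ i, sandwich (coeff i) (f (size i) (μ i)) := by
  have h1 := hf n (ConvexCoeffs.ofFintype size coeff h) fun i => μ ((Fintype.equivFin ι).symm i)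
  refine Eq.trans ?_ (h1.trans
    (ConvexCoeffs.comb_ofFintype size coeff h fun i => f (size i) (μ i)))
  congr 1
  exact Subtype.ext (ConvexCoeffs.comb_ofFintype size coeff h
    fun i => (μ i : Matrix (Fin (size i)) (Fin (size i)) V)).symm

theorem CompactMatrixConvexSet.sandwich_mem (L : CompactMatrixConvexSet V) {m : ℕ+}
    (γ : Matrix (Fin m) (Fin n) ℂ) (h : γ.conjTranspose * γ = 1) (μ : L.level m) :
    sandwich γ (μ : Matrix (Fin m) (Fin m) V) ∈ L.level n := by
  have h' : ∑ _i : Unit, γ.conjTranspose * γ = 1 := by simpa using h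
  simpa using L.sum_sandwich_mem (fun _ => m) (fun _ => γ) h' fun _ => μ

theorem IsMatrixAffine.map_sandwich {L : CompactMatrixConvexSet V}
    {f : ∀ n : ℕ+, L.level n → Matrix (Fin n) (Fin n) W} (hf : IsMatrixAffine L f) {m : ℕ+}
    (γ : Matrix (Fin m) (Fin n) ℂ) (h : γ.conjTranspose * γ = 1) (μ : L.level m) :
    f n ⟨_, L.sandwich_mem γ h μ⟩ = sandwich γ (f m μ) := by
  have h' : ∑ _i : Unit, γ.conjTranspose * γ = 1 := by simpa using h
  simpa using hf.map_sum_sandwich (fun _ => m) (fun _ => γ) h' fun _ => μ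

/-- If some level is nonempty then so are all levels. -/
theorem CompactMatrixConvexSet.level_nonempty (L : CompactMatrixConvexSet V) {m : ℕ+}
    (μ : L.level m) (n : ℕ+) : Nonempty (L.level n) := by
  -- The matrix units `E_{0j}` satisfy `∑ E_{0j}* E_{0j} = ∑ E_{jj} = 1`; the point obtained is
  -- diagonal, with `μ_{00}` repeated `n` times.
  refine ⟨⟨_, L.sum_sandwich_mem (ι := Fin n) (fun _ => m)
    (fun j => Matrix.single (⟨0, m.pos⟩ : Fin m) j 1) ?_ fun _ => μ⟩⟩
  simp only [Matrix.conjTranspose_single, star_one, Matrix.single_mul_single_same, mul_one]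
  ext i j
  simp [Matrix.sum_apply, Matrix.single_apply, Matrix.one_apply, ite_and]

end Combinations

/-! ### Quadratic forms of block matrices -/

section Pairing

variable {m n r : ℕ}

/-- For a block matrix `[M_{kl}]`, the real part of its quadratic form at the vector with
components `γ_{pk}`. -/
def pairing (γ : Matrix (Fin r) (Fin n) ℂ)
    (M : Matrix (Fin n) (Fin n) (Matrix (Fin r) (Fin r) ℂ)) : ℝ :=
  (∑ k, ∑ l, sandwich γ (M k l) k l).re

theorem pairing_eq (γ : Matrix (Fin r) (Fin n) ℂ)
    (M : Matrix (Fin n) (Fin n) (Matrix (Fin r) (Fin r) ℂ)) :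
    pairing γ M = (∑ k, ∑ l, ∑ p, ∑ q, star (γ p k) * γ q l * M k l p q).re := rfl

theorem pairing_mul {s : ℕ} (δ : Matrix (Fin s) (Fin r) ℂ) (γ : Matrix (Fin r) (Fin n) ℂ)
    (M : Matrix (Fin n) (Fin n) (Matrix (Fin s) (Fin s) ℂ)) :
    pairing (δ * γ) M = pairing γ (M.map (sandwich δ)) := by
  simp only [pairing, Matrix.map_apply, sandwich_sandwich]

theorem pairing_add (γ : Matrix (Fin r) (Fin n) ℂ)
    (M N : Matrix (Fin n) (Fin n) (Matrix (Fin r) (Fin r) ℂ)) :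
    pairing γ (M + N) = pairing γ M + pairing γ N := by
  simp only [pairing, Matrix.add_apply, sandwich_add, Finset.sum_add_distrib, Complex.add_re]

theorem pairing_real_smul (γ : Matrix (Fin r) (Fin n) ℂ) (t : ℝ)
    (M : Matrix (Fin n) (Fin n) (Matrix (Fin r) (Fin r) ℂ)) :
    pairing γ ((t : ℂ) • M) = t * pairing γ M := by
  simp only [pairing, Matrix.smul_apply, sandwich_smul, smul_eq_mul, ← Finset.mul_sum,
    Complex.re_ofReal_mul]

theorem pairing_real_smul_left (γ : Matrix (Fin r) (Fin n) ℂ) (t : ℝ)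
    (M : Matrix (Fin n) (Fin n) (Matrix (Fin r) (Fin r) ℂ)) :
    pairing ((t : ℂ) • γ) M = t ^ 2 * pairing γ M := by
  simp only [pairing, sandwich_real_smul_left, Matrix.smul_apply, smul_eq_mul, ← Finset.mul_sum,
    Complex.re_ofReal_mul]

theorem pairing_sum {ι : Type*} (s : Finset ι) (γ : Matrix (Fin r) (Fin n) ℂ)
    (M : ι → Matrix (Fin n) (Fin n) (Matrix (Fin r) (Fin r) ℂ)) :
    pairing γ (∑ i ∈ s, M i) = ∑ i ∈ s, pairing γ (M i) := by
  classical
  induction s using Finset.induction_on with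
  | empty => simp [pairing, sandwich_apply]
  | insert i s hi ih => rw [Finset.sum_insert hi, Finset.sum_insert hi, pairing_add, ih]

/-- Taking adjoints conjugates the value of the form, so its real part sees only the hermitian part
of a block matrix. -/
theorem pairing_conjTranspose (γ : Matrix (Fin r) (Fin n) ℂ)
    (M : Matrix (Fin n) (Fin n) (Matrix (Fin r) (Fin r) ℂ)) :
    pairing γ M.conjTranspose = pairing γ M := by
  rw [pairing_eq, pairing_eq, ← Complex.conj_re]
  congr 1
  simp only [map_sum]
  rw [Finset.sum_comm]
  refine Finset.sum_congr rfl fun k _ => Finset.sum_congr rfl fun l _ => ?_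
  rw [Finset.sum_comm]
  refine Finset.sum_congr rfl fun p _ => Finset.sum_congr rfl fun q _ => ?_
  simp only [Matrix.conjTranspose_apply, Matrix.star_apply, map_mul, Complex.star_def,
    Complex.conj_conj]
  ring

/-- Compressing the outer index by a scalar matrix. -/
theorem pairing_sandwich (γ : Matrix (Fin r) (Fin n) ℂ) (c : Matrix (Fin m) (Fin n) ℂ)
    (M : Matrix (Fin m) (Fin m) (Matrix (Fin r) (Fin r) ℂ)) :
    pairing γ (sandwich c M) = pairing (γ * c.transpose) M := by
  rw [pairing_eq, pairing_eq]
  congr 1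
  simp only [sandwich_apply, Matrix.sum_apply, Matrix.smul_apply, smul_eq_mul, Matrix.mul_apply,
    Matrix.transpose_apply, star_sum, star_mul', Finset.mul_sum, Finset.sum_mul]
  simp only [← Fintype.sum_prod_type']
  refine Fintype.sum_equiv
    { toFun := fun x => (x.2.2.2.2.1, x.2.2.2.2.2, x.2.2.1, x.2.2.2.1, x.2.1, x.1)
      invFun := fun x => (x.2.2.2.2.2, x.2.2.2.2.1, x.2.2.1, x.2.2.2.1, x.1, x.2.1)
      left_inv := fun _ => rfl
      right_inv := fun _ => rfl } _ _ fun x => ?_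
  simp only [Equiv.coe_fn_mk]
  ring

end Pairing

/-! ### Positive matrices over an operator system -/

section Positivity

universe u v

/-- In a C*-algebra, a finite sum of elements `b* b` is again of this form. -/
theorem exists_star_mul_self_eq_sum {B : Type*} [CStarAlgebra B] {ι : Type*} [Fintype ι]
    (b : ι → B) : ∃ c : B, ∑ p, star (b p) * b p = star c * c := by
  let := CStarAlgebra.spectralOrder B
  have := CStarAlgebra.spectralOrderedRing B
  exact CStarAlgebra.nonneg_iff_eq_star_mul_self.1
    (Finset.sum_nonneg fun p _ => star_mul_self_nonneg _)

/-- Positive matrices over an operator system are exactly the Gram matrices of finitely many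
vectors over the ambient C*-algebra. -/
theorem OperatorSystem.isPositive_iff_gram (S : OperatorSystem.{u}) {n : ℕ}
    (a : Matrix (Fin n) (Fin n) S.carrier) :
    S.IsPositive a ↔ ∃ (ι : Type) (_ : Fintype ι) (e : ι → Fin n → S.ambient),
      ∀ i j, (a i j : S.ambient) = ∑ p, star (e p i) * e p j := by
  constructor
  · rintro ⟨b, hb⟩
    exact ⟨Fin n, inferInstance, b, fun i j => congrFun (congrFun hb i) j⟩
  · rintro ⟨ι, _, e, he⟩
    -- Size `0` is treated apart because the construction below needs a row with index `0`.
    obtain _ | n := n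
    · exact ⟨0, Matrix.ext fun i => i.elim0⟩
    let := CStarAlgebra.spectralOrder S.ambient
    have := CStarAlgebra.spectralOrderedRing S.ambient
    -- Each vector `e p` becomes the only nonzero row of a square matrix, so that the Gram matrix is
    -- `∑ B_p* B_p` in a C*-algebra of matrices, where such a sum is again of the form `c* c`.
    let B : ι → CStarMatrix (Fin (n + 1)) (Fin (n + 1)) S.ambient := fun p =>
      CStarMatrix.ofMatrix (Matrix.of fun k j => if k = 0 then e p j else 0)
    obtain ⟨c, hc⟩ := exists_star_mul_self_eq_sum B
    refine ⟨CStarMatrix.ofMatrix.symm c, ?_⟩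
    ext i j
    have h1 : (∑ p, star (B p) * B p) i j = ∑ p, star (e p i) * e p j := by
      have : ∀ p, (star (B p) * B p) i j = star (e p i) * e p j := fun p => by
        change ∑ k, star (B p k i) * B p k j = _
        rw [Finset.sum_eq_single 0]
        · rfl
        · intro k _ hk
          have : B p k j = 0 := if_neg hk
          rw [this, mul_zero]
        · simp
      rw [← Finset.sum_congr rfl fun p _ => this p]
      exact map_sum (AddMonoidHom.mk' (fun M : CStarMatrix (Fin (n + 1)) (Fin (n + 1)) S.ambient =>
        M i j) fun _ _ => rfl) _ _
    rw [Matrix.map_apply, he, ← h1, hc]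
    rfl

namespace OperatorSystem

variable {S : OperatorSystem.{u}} {n m : ℕ} {a b : Matrix (Fin n) (Fin n) S.carrier}

theorem IsPositive.add (ha : S.IsPositive a) (hb : S.IsPositive b) : S.IsPositive (a + b) := by
  rw [isPositive_iff_gram] at *
  obtain ⟨ι, _, e, he⟩ := ha
  obtain ⟨κ, _, d, hd⟩ := hb
  refine ⟨ι ⊕ κ, inferInstance, Sum.elim e d, fun i j => ?_⟩
  simp only [Matrix.add_apply, Submodule.coe_add, he, hd, Fintype.sum_sum_type, Sum.elim_inl,
    Sum.elim_inr]

theorem isPositive_zero : S.IsPositive (0 : Matrix (Fin n) (Fin n) S.carrier) :=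
  (isPositive_iff_gram S _).2 ⟨Empty, inferInstance, Empty.elim, fun i j => by simp⟩

theorem isPositive_sum {ι : Type*} (s : Finset ι) (a : ι → Matrix (Fin n) (Fin n) S.carrier)
    (ha : ∀ i ∈ s, S.IsPositive (a i)) : S.IsPositive (∑ i ∈ s, a i) :=
  Finset.sum_induction a S.IsPositive (fun _ _ => IsPositive.add) isPositive_zero ha

theorem IsPositive.sandwich (ha : S.IsPositive a) (c : Matrix (Fin n) (Fin m) ℂ) :
    S.IsPositive (sandwich c a) := by
  rw [isPositive_iff_gram] at *
  obtain ⟨ι, _, e, he⟩ := ha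
  refine ⟨ι, inferInstance, fun p i => ∑ k, c k i • e p k, fun i j => ?_⟩
  simp only [sandwich_apply, Submodule.coe_sum, Submodule.coe_smul, he, star_sum, star_smul,
    Finset.sum_mul, Finset.mul_sum, Finset.smul_sum, smul_mul_smul_comm]
  calc
    _ = ∑ k, ∑ p, ∑ l, (star (c k i) * c l j) • (star (e p k) * e p l) :=
      Finset.sum_congr rfl fun _ _ => Finset.sum_comm
    _ = ∑ p, ∑ k, ∑ l, (star (c k i) * c l j) • (star (e p k) * e p l) := Finset.sum_comm
    _ = _ := Finset.sum_congr rfl fun _ _ => Finset.sum_comm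

theorem IsPositive.real_smul (ha : S.IsPositive a) {t : ℝ} (ht : 0 ≤ t) :
    S.IsPositive ((t : ℂ) • a) := by
  have h := ha.sandwich (((√t : ℝ) : ℂ) • (1 : Matrix (Fin n) (Fin n) ℂ))
  rwa [sandwich_real_smul_left, Real.sq_sqrt ht, sandwich_one] at h

theorem IsPositive.star_apply (ha : S.IsPositive a) (i j : Fin n) :
    star (a i j : S.ambient) = a j i := by
  obtain ⟨b, hb⟩ := ha
  have h : ∀ i j, (a i j : S.ambient) = (b.conjTranspose * b) i j :=
    fun i j => congrFun (congrFun hb i) j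
  rw [h, h, ← Matrix.star_apply, Matrix.star_eq_conjTranspose, Matrix.conjTranspose_mul,
    Matrix.conjTranspose_conjTranspose]

/-- The adjoint on an operator system. -/
def adj (S : OperatorSystem.{u}) (x : S.carrier) : S.carrier :=
  ⟨star (x : S.ambient), S.star_mem _ x.2⟩

theorem coe_adj (x : S.carrier) : (S.adj x : S.ambient) = star (x : S.ambient) := rfl

/-- A self-adjoint element becomes positive after adding a large multiple of the unit. -/
theorem isPositive_unit_add (x : S.carrier) (hx : S.adj x = x) :
    S.IsPositive (Matrix.of fun _ _ : Fin 1 => ((‖(x : S.ambient)‖ : ℝ) : ℂ) • S.unit + x) := by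
  let := CStarAlgebra.spectralOrder S.ambient
  have := CStarAlgebra.spectralOrderedRing S.ambient
  have hx' : IsSelfAdjoint (x : S.ambient) := congrArg Subtype.val hx
  have h := IsSelfAdjoint.neg_algebraMap_norm_le_self (a := (x : S.ambient)) hx'
  rw [neg_le_iff_add_nonneg'] at h
  obtain ⟨c, hc⟩ := CStarAlgebra.nonneg_iff_eq_star_mul_self.1 h
  refine (isPositive_iff_gram S _).2 ⟨Unit, inferInstance, fun _ _ => c, fun i j => ?_⟩
  rw [Finset.univ_unique, Finset.sum_singleton, ← hc]
  change ((‖(x : S.ambient)‖ : ℝ) : ℂ) • (1 : S.ambient) + x = _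
  congr 1
  rw [Algebra.algebraMap_eq_smul_one]
  exact Complex.coe_smul _ _

end OperatorSystem

variable {S : OperatorSystem.{u}} {T : OperatorSystem.{v}} {φ : S.carrier →ₗ[ℂ] T.carrier}

/-- The image of the positive element `‖x‖ • 1 + x` is positive, hence self-adjoint, and its first
summand is mapped to a real multiple of the unit, which can be cancelled. -/
theorem IsUCP.map_adj_of_eq (hφ : IsUCP S T φ) (x : S.carrier) (hx : S.adj x = x) :
    T.adj (φ x) = φ x := by
  have h := (hφ.map_positive 1 _ (S.isPositive_unit_add x hx)).star_apply 0 0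
  simp only [Matrix.map_apply, Matrix.of_apply, map_add, map_smul, hφ.map_unit,
    Submodule.coe_add, Submodule.coe_smul, star_add, star_smul, Complex.star_def,
    Complex.conj_ofReal] at h
  have h1 : star (T.unit : T.ambient) = T.unit := star_one _
  rw [h1] at h
  exact Subtype.ext (add_left_cancel h)

/-- Unital completely positive maps preserve adjoints. -/
theorem IsUCP.map_adj (hφ : IsUCP S T φ) (x : S.carrier) : φ (S.adj x) = T.adj (φ x) := by
  -- The self-adjoint elements `x + x*` and `i(x - x*)` together determine `φ(x*)`.
  have h1 := hφ.map_adj_of_eq (x + S.adj x) (Subtype.ext (by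
    simp [OperatorSystem.coe_adj, add_comm]))
  have h2 := hφ.map_adj_of_eq (Complex.I • (x - S.adj x)) (Subtype.ext (by
    simp only [OperatorSystem.coe_adj, Submodule.coe_smul, Submodule.coe_sub, star_smul, star_sub,
      star_star, Complex.star_def, Complex.conj_I, neg_smul, ← smul_neg, neg_sub]))
  have h1' := congrArg Subtype.val h1
  have h2' := congrArg Subtype.val h2
  apply Subtype.ext
  simp only [OperatorSystem.coe_adj, map_add, map_smul, map_sub, Submodule.coe_add,
    Submodule.coe_smul, Submodule.coe_sub, star_add, star_smul, star_sub, Complex.star_def,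
    Complex.conj_I, neg_smul, ← smul_neg, neg_sub] at h1' h2' ⊢
  have h3 : star (φ (S.adj x) : T.ambient) - star (φ x : T.ambient) = φ x - φ (S.adj x) :=
    smul_right_injective T.ambient Complex.I_ne_zero h2'
  have h4 : (2 : ℂ) • (φ (S.adj x) : T.ambient) = (2 : ℂ) • star (φ x : T.ambient) := by
    rw [two_smul, two_smul]
    calc
      _ = (φ x + φ (S.adj x) : T.ambient) - (φ x - φ (S.adj x)) := by abel
      _ = _ := by rw [← h1', ← h3]; abel
  exact smul_right_injective T.ambient two_ne_zero h4

end Positivity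

/-! ### Positivity over `A(K)` is pointwise -/

section PositivityInAffineFunctions

open scoped Matrix.Norms.L2Operator MatrixOrder ComplexOrder

universe v

variable {V : Type v} [AddCommGroup V] [Module ℂ V] [TopologicalSpace V]
  {K : CompactMatrixConvexSet V} {n : ℕ}

/-- Evaluation of affine functions at a point of `K_r`. -/
def evalHom (K : CompactMatrixConvexSet V) {r : ℕ+} (ν : K.level r) :
    affineFunctionSpace K →ₗ[ℂ] Matrix (Fin r) (Fin r) ℂ where
  toFun x := (x : BoundedFamilies K) ⟨r, ν⟩
  map_add' _ _ := rfl
  map_smul' _ _ := rfl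

theorem evalHom_apply {r : ℕ+} (ν : K.level r) (x : affineFunctionSpace K) :
    evalHom K ν x = (x : BoundedFamilies K) ⟨r, ν⟩ := rfl

theorem evalHom_ext {x y : affineFunctionSpace K}
    (h : ∀ (r : ℕ+) (ν : K.level r), evalHom K ν x = evalHom K ν y) : x = y :=
  Subtype.ext (lp.ext (funext fun p => h p.1 p.2))

/-- The form equals the sum over `p` and `s` of the squared moduli of `∑ k, (E p k * γ) s k`. -/
theorem pairing_gram_nonneg {r : ℕ} {ι : Type*} [Fintype ι] (γ : Matrix (Fin r) (Fin n) ℂ)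
    (E : ι → Fin n → Matrix (Fin r) (Fin r) ℂ) :
    0 ≤ pairing γ (Matrix.of fun k l => ∑ p, star (E p k) * E p l) := by
  have h : ∀ k l, sandwich γ (∑ p, star (E p k) * E p l) k l =
      ∑ p, ∑ s, star ((E p k * γ) s k) * (E p l * γ) s l := fun k l => by
    rw [sandwich_sum, Matrix.sum_apply]
    refine Finset.sum_congr rfl fun p _ => ?_
    rw [sandwich_complex, Matrix.star_eq_conjTranspose, ← Matrix.mul_assoc,
      ← Matrix.conjTranspose_mul, Matrix.mul_assoc, Matrix.mul_apply]
    rfl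
  have h2 : ∑ k, ∑ l, sandwich γ (∑ p, star (E p k) * E p l) k l =
      ∑ p, ∑ s, star (∑ k, (E p k * γ) s k) * ∑ k, (E p k * γ) s k := by
    simp only [h, star_sum, Finset.sum_mul, Finset.mul_sum]
    simp only [← Fintype.sum_prod_type']
    exact Fintype.sum_equiv
      { toFun := fun x => (x.2.2.1, x.2.2.2, x.2.1, x.1)
        invFun := fun x => (x.2.2.2, x.2.2.1, x.1, x.2.1)
        left_inv := fun _ => rfl
        right_inv := fun _ => rfl } _ _ fun x => rfl
  simp only [pairing, Matrix.of_apply, h2, Complex.re_sum]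
  refine Finset.sum_nonneg fun p _ => Finset.sum_nonneg fun s _ => ?_
  rw [Complex.star_def, mul_comm, Complex.mul_conj, Complex.ofReal_re]
  exact Complex.normSq_nonneg _

/-- A hermitian block matrix with nonnegative quadratic form is a Gram matrix of blocks. -/
theorem exists_gram_of_pairing_nonneg {r : ℕ}
    {M : Matrix (Fin n) (Fin n) (Matrix (Fin r) (Fin r) ℂ)} (hM : M.conjTranspose = M)
    (h : ∀ γ : Matrix (Fin r) (Fin n) ℂ, 0 ≤ pairing γ M) :
    ∃ E : Fin n → Fin n → Matrix (Fin r) (Fin r) ℂ,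
      ∀ k l, M k l = ∑ p, star (E p k) * E p l := by
  let B : Matrix (Fin n × Fin r) (Fin n × Fin r) ℂ := Matrix.of fun x y => M x.1 y.1 x.2 y.2
  have hB : B.IsHermitian := by
    ext x y
    have := congrFun (congrFun (congrFun (congrFun hM x.1) y.1) x.2) y.2
    exact this
  have hpos : B.PosSemidef := by
    refine Matrix.PosSemidef.of_dotProduct_mulVec_nonneg hB fun x => ?_
    -- Hermiticity makes the form real, so the hypothesis on its real part suffices.
    have him := hB.im_star_dotProduct_mulVec_self x
    have hre : 0 ≤ (star x ⬝ᵥ B.mulVec x).re := by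
      refine (h (Matrix.of fun p k => x (k, p))).trans_eq ?_
      rw [pairing_eq]
      congr 1
      simp only [dotProduct, Matrix.mulVec, Finset.mul_sum, Fintype.sum_prod_type, Matrix.of_apply,
        Pi.star_apply, B]
      refine Finset.sum_congr rfl fun k _ => ?_
      rw [Finset.sum_comm]
      refine Finset.sum_congr rfl fun p _ => Finset.sum_congr rfl fun l _ =>
        Finset.sum_congr rfl fun q _ => ?_
      ring
    exact Complex.nonneg_iff.2 ⟨hre, him.symm⟩
  obtain ⟨D, hD⟩ := CStarAlgebra.nonneg_iff_eq_star_mul_self.1 hpos.nonneg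
  -- With the `n r × n r` matrix written as `D* D`, the blocks of `D` are the required vectors.
  refine ⟨fun p k => Matrix.of fun s q => D (p, s) (k, q), fun k l => ?_⟩
  ext p q
  have h1 := congrFun (congrFun hD (k, p)) (l, q)
  rw [Matrix.mul_apply, Fintype.sum_prod_type] at h1
  rw [Matrix.sum_apply]
  exact h1

theorem map_evalHom_conjTranspose {a : Matrix (Fin n) (Fin n) (affineFunctionSpace K)} {r : ℕ+}
    (ν : K.level r) (ha : ∀ i j, (affineFunctions K).adj (a i j) = a j i) :
    (a.map (evalHom K ν)).conjTranspose = a.map (evalHom K ν) := by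
  ext i j : 2
  rw [Matrix.conjTranspose_apply, Matrix.map_apply, Matrix.map_apply, ← ha j i]
  rfl

/-- Positivity in `M_n(A(K))` is pointwise positivity. -/
theorem isPositive_affineFunctions_iff (a : Matrix (Fin n) (Fin n) (affineFunctionSpace K)) :
    (affineFunctions K).IsPositive a ↔
      (∀ i j, (affineFunctions K).adj (a i j) = a j i) ∧
        ∀ (r : ℕ+) (ν : K.level r) (γ : Matrix (Fin r) (Fin n) ℂ),
          0 ≤ pairing γ (a.map (evalHom K ν)) := by
  constructor
  · intro ha
    refine ⟨fun i j => Subtype.ext (ha.star_apply i j), fun r ν γ => ?_⟩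
    obtain ⟨ι, _, e, he⟩ := (OperatorSystem.isPositive_iff_gram _ _).1 ha
    change ι → Fin n → BoundedFamilies K at e
    have h : a.map (evalHom K ν) = Matrix.of fun k l =>
        ∑ p, star (e p k ⟨r, ν⟩) * e p l ⟨r, ν⟩ := by
      ext k l : 2
      have h1 : (a k l : BoundedFamilies K) = ∑ p, star (e p k) * e p l := he k l
      rw [Matrix.map_apply, evalHom_apply, h1]
      simp only [lp.coeFn_sum, Finset.sum_apply, lp.infty_coeFn_mul, Pi.mul_apply, lp.coeFn_star,
        Pi.star_apply, Matrix.of_apply]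
    rw [h]
    exact pairing_gram_nonneg γ fun p k => e p k ⟨r, ν⟩
  · rintro ⟨ha, hpos⟩
    choose E hE using fun p : Σ r : ℕ+, K.level r =>
      exists_gram_of_pairing_nonneg (map_evalHom_conjTranspose p.2 ha) (hpos p.1 p.2)
    -- The factors are chosen independently at each point and must be bounded to lie in the
    -- `ℓ^∞`-product: `E_{kl}* E_{kl}` is dominated by the diagonal entry `a_{ll}`.
    have hbound : ∀ p k l, ‖E p k l‖ ^ 2 ≤ ‖(a l l : BoundedFamilies K)‖ := fun p k l => by
      have h1 : star (E p k l) * E p k l ≤ ∑ k, star (E p k l) * E p k l :=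
        Finset.single_le_sum (f := fun k => star (E p k l) * E p k l)
          (fun _ _ => star_mul_self_nonneg _) (Finset.mem_univ k)
      rw [← hE p l l] at h1
      rw [sq, ← CStarRing.norm_star_mul_self]
      exact (CStarAlgebra.norm_le_norm_of_nonneg_of_le (star_mul_self_nonneg _) h1).trans
        (lp.norm_apply_le_norm ENNReal.top_ne_zero (a l l : BoundedFamilies K) p)
    let e : Fin n → Fin n → BoundedFamilies K := fun k l =>
      ⟨fun p => E p k l, memℓp_infty ⟨√‖(a l l : BoundedFamilies K)‖, by
        rintro _ ⟨p, rfl⟩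
        exact Real.le_sqrt_of_sq_le (hbound p k l)⟩⟩
    refine (OperatorSystem.isPositive_iff_gram _ _).2 ⟨Fin n, inferInstance, e, fun i j => ?_⟩
    change (a i j : BoundedFamilies K) = ∑ p, star (e p i) * e p j
    apply lp.ext
    funext p
    simp only [lp.coeFn_sum, Finset.sum_apply, lp.infty_coeFn_mul, Pi.mul_apply, lp.coeFn_star,
      Pi.star_apply]
    exact hE p i j

end PositivityInAffineFunctions

/-! ### The embedding `A(K) → A(L)` -/

section Pullback

universe v w

variable {G : Type*} [Group G] {V : Type v} [AddCommGroup V] [Module ℂ V] [TopologicalSpace V]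
  {W : Type w} [AddCommGroup W] [Module ℂ W] [TopologicalSpace W]

theorem evalHom_pullback {L : CompactMatrixConvexSet V} {K : CompactMatrixConvexSet W}
    (f : ContMatrixAffineMap L K) (x : affineFunctionSpace K) {r : ℕ+} (μ : L.level r) :
    evalHom L μ (f.pullback x) = evalHom K (f.toFun r μ) x := rfl

/-- A surjective equivariant map `L → K` induces an embedding `A(K) → A(L)`. -/
theorem IsEquivariant.isEmbedding_pullback {L : MatrixAffineSystem G V} {K : MatrixAffineSystem G W}
    {f : ContMatrixAffineMap L.toCompactMatrixConvexSet K.toCompactMatrixConvexSet}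
    (hequiv : IsEquivariant L K f) (hsurj : ∀ n, Function.Surjective (f.toFun n)) :
    IsEmbedding (affineFunctionSystem K) (affineFunctionSystem L) f.pullback := by
  have hinj : Function.Injective f.pullback := fun x y hxy => evalHom_ext fun r ν => by
    obtain ⟨μ, rfl⟩ := hsurj r ν
    rw [← evalHom_pullback, ← evalHom_pullback, hxy]
  refine ⟨⟨f.pullback_ucp, fun s x => evalHom_ext fun r μ => ?_⟩, hinj, fun n a ha => ?_⟩
  · exact congrArg (fun ν => evalHom K.toCompactMatrixConvexSet ν x) (hequiv s⁻¹ r μ).symm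
  · have ha' := (isPositive_affineFunctions_iff (K := L.toCompactMatrixConvexSet) _).1 ha
    refine (isPositive_affineFunctions_iff (K := K.toCompactMatrixConvexSet) a).2
      ⟨fun i j => hinj (ha'.1 i j), fun r ν γ => ?_⟩
    obtain ⟨μ, rfl⟩ := hsurj r ν
    exact ha'.2 r μ γ

end Pullback

/-! ### Continuity of affine functions at every level -/

section Continuity

universe v

variable {V : Type v} [AddCommGroup V] [Module ℂ V] [TopologicalSpace V] [ContinuousAdd V]
  [ContinuousSMul ℂ V] {L : CompactMatrixConvexSet V} {n : ℕ+}

/-- Continuity is only known on `L_1`. The unit column `u = c / ‖c‖` compresses `μ` to a point of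
`L_1`, and the form at `c` is `‖c‖²` times the value of `x` there. -/
theorem continuous_quadratic_evalHom (x : affineFunctionSpace L) (c : Fin n → ℂ) :
    Continuous fun μ : L.level n => star c ⬝ᵥ (evalHom L μ x).mulVec c := by
  by_cases hc : c = 0
  · simp only [hc, Matrix.mulVec_zero, dotProduct_zero, continuous_const]
  have hc' : (WithLp.toLp 2 c : EuclideanSpace ℂ (Fin n)) ≠ 0 := fun h =>
    hc (congrArg WithLp.ofLp h)
  set t := ‖(WithLp.toLp 2 c : EuclideanSpace ℂ (Fin n))‖ with ht
  have ht0 : t ≠ 0 := norm_ne_zero_iff.2 hc'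
  have ht2 : star c ⬝ᵥ c = ((t ^ 2 : ℝ) : ℂ) := by
    rw [ht, EuclideanSpace.norm_sq_eq, dotProduct]
    push_cast
    refine Finset.sum_congr rfl fun i _ => ?_
    rw [Pi.star_apply, Complex.star_def, mul_comm, Complex.mul_conj, Complex.normSq_eq_norm_sq]
    push_cast
    rfl
  let u : Matrix (Fin n) (Fin (1 : ℕ+)) ℂ := Matrix.of fun i _ => ((t⁻¹ : ℝ) : ℂ) * c i
  have hu : u.conjTranspose * u = 1 := by
    ext i j
    have hij : i = j := Subsingleton.elim (α := Fin 1) i j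
    subst hij
    rw [Matrix.mul_apply, Matrix.one_apply_eq]
    have : ∀ k, u.conjTranspose i k * u k i = ((t⁻¹ ^ 2 : ℝ) : ℂ) * (star c k * c k) := fun k => by
      simp only [u, Matrix.conjTranspose_apply, Matrix.of_apply, star_mul', Pi.star_apply,
        Complex.star_def, Complex.conj_ofReal]
      push_cast
      ring
    rw [Finset.sum_congr rfl fun k _ => this k, ← Finset.mul_sum]
    change _ * (star c ⬝ᵥ c) = 1
    rw [ht2, ← Complex.ofReal_mul, inv_pow, inv_mul_cancel₀ (pow_ne_zero 2 ht0), Complex.ofReal_one]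
  have hcont : Continuous fun μ : L.level n =>
      (⟨_, L.sandwich_mem u hu μ⟩ : L.level 1) :=
    (continuous_sandwich.comp (continuous_const.prodMk continuous_subtype_val)).subtype_mk _
  have h1 := (x.2.continuous_one.comp hcont).matrix_elem 0 0
  have h2 : (fun μ : L.level n => star c ⬝ᵥ (evalHom L μ x).mulVec c) = fun μ : L.level n =>
      ((t ^ 2 : ℝ) : ℂ) * evalHom L ⟨_, L.sandwich_mem u hu μ⟩ x 0 0 := by
    funext μ
    have h3 : evalHom L ⟨_, L.sandwich_mem u hu μ⟩ x = sandwich u (evalHom L μ x) :=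
      x.2.affine.map_sandwich u hu μ
    rw [h3, sandwich_apply]
    simp only [dotProduct, Matrix.mulVec, Finset.mul_sum, smul_eq_mul, u, Matrix.of_apply,
      star_mul', Pi.star_apply, Complex.star_def, Complex.conj_ofReal]
    refine Finset.sum_congr rfl fun k _ => Finset.sum_congr rfl fun l _ => ?_
    push_cast
    have : (t : ℂ) ≠ 0 := Complex.ofReal_ne_zero.2 ht0
    field_simp
  rw [h2]
  exact continuous_const.mul h1

/-- The functions in `A(L)` are continuous at every level. -/
theorem continuous_evalHom (x : affineFunctionSpace L) :
    Continuous fun μ : L.level n => evalHom L μ x := by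
  refine continuous_matrix fun p q => ?_
  -- Polarization: each matrix entry is a fixed linear combination of four values of the quadratic
  -- form.
  have h : ∀ M : Matrix (Fin n) (Fin n) ℂ, M p q =
      (2⁻¹ : ℂ) * ((star (Pi.single p 1 + Pi.single q 1) ⬝ᵥ M.mulVec (Pi.single p 1 + Pi.single q 1))
        - Complex.I * (star (Pi.single p 1 + Complex.I • Pi.single q 1) ⬝ᵥ
            M.mulVec (Pi.single p 1 + Complex.I • Pi.single q 1))
        - (1 - Complex.I) * ((star (Pi.single p 1) ⬝ᵥ M.mulVec (Pi.single p 1)) +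
            (star (Pi.single q 1) ⬝ᵥ M.mulVec (Pi.single q 1)))) := fun M => by
    simp only [star_add, star_smul, Pi.star_single, star_one, Matrix.mulVec_add, Matrix.mulVec_smul,
      dotProduct_add, add_dotProduct, smul_dotProduct, dotProduct_smul, Matrix.mulVec_single_one,
      single_one_dotProduct, Matrix.col_apply, smul_eq_mul, Complex.star_def, Complex.conj_I]
    ring_nf
    simp only [Complex.I_sq, Complex.I_pow_three]
    ring
  have hc := fun c : Fin n → ℂ => continuous_quadratic_evalHom x c
  have heq : (fun μ : L.level n => evalHom L μ x p q) = _ := funext fun μ => h (evalHom L μ x)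
  rw [heq]
  exact continuous_const.mul ((((hc _)).sub (continuous_const.mul (hc _))).sub
    (continuous_const.mul ((hc _).add (hc _))))

end Continuity

/-! ### The compact convex set of compressed points -/

section Separation

universe v w

variable {V : Type v} [AddCommGroup V] [Module ℂ V] [TopologicalSpace V]
  {W : Type w} [AddCommGroup W] [Module ℂ W] [TopologicalSpace W]

/-- The affine function `ν ↦ Φ(ν) + z • 1` given by a continuous linear functional `Φ`. -/
theorem exists_evalHom_eq_map_add_smul_one (K : CompactMatrixConvexSet W) (Φ : W →L[ℂ] ℂ) (z : ℂ) :
    ∃ x : affineFunctionSpace K, ∀ (r : ℕ+) (ν : K.level r),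
      evalHom K ν x = (ν : Matrix (Fin r) (Fin r) W).map Φ + z • (1 : Matrix (Fin r) (Fin r) ℂ) := by
  obtain ⟨x, hx, h⟩ := exists_mem_affineFunctionSpace K
    (fun r ν => (ν : Matrix (Fin r) (Fin r) W).map Φ + z • (1 : Matrix (Fin r) (Fin r) ℂ))
    ⟨fun n c μ => by
      have h1 := c.comb_add (fun i => (μ i : Matrix (Fin (c.size i)) (Fin (c.size i)) W).map Φ)
        fun i => z • 1
      have h2 := c.comb_smul z fun i => 1
      have h3 : c.comb (fun i => (μ i : Matrix (Fin (c.size i)) (Fin (c.size i)) W).map Φ) =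
          (c.comb fun i => (μ i : Matrix (Fin (c.size i)) (Fin (c.size i)) W)).map Φ := by
        simp only [ConvexCoeffs.comb]
        rw [← Φ.coe_coe]
        ext i j
        simp only [Matrix.sum_apply, Matrix.map_apply, map_sum]
        refine Finset.sum_congr rfl fun k _ => ?_
        exact (congrFun (congrFun (sandwich_map (Φ : W →ₗ[ℂ] ℂ) (c.coeff k) (μ k).1) i) j).symm
      dsimp only
      rw [h1, h2, h3, c.comb_one],
    (continuous_matrix fun i j => Φ.continuous.comp (continuous_subtype_val.matrix_elem i j)).add
      continuous_const⟩
  exact ⟨⟨x, hx⟩, h⟩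

variable {L : CompactMatrixConvexSet V} {K : CompactMatrixConvexSet W} {n : ℕ+}

/-- The space in which compressed points of `L` are separated. -/
abbrev CompressionSpace (W : Type w) (n : ℕ+) (S : Type*) : Type _ :=
  (Fin n → Fin n → W) × (Fin n → Fin n → ℂ) × (S → ℂ)

/-- The data `(γ* f(μ) γ, γ* γ, ⟨a(μ) γ, γ⟩)` of a point `μ ∈ L_r` compressed by `γ ∈ M_{r,n}`. -/
noncomputable def compression (f : ContMatrixAffineMap L K)
    (s : Finset (Matrix (Fin n) (Fin n) (affineFunctionSpace L))) {r : ℕ+}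
    (γ : Matrix (Fin r) (Fin n) ℂ) (μ : L.level r) : CompressionSpace W n s :=
  (sandwich γ (f.toFun r μ : Matrix (Fin r) (Fin r) W), γ.conjTranspose * γ,
    fun a => (pairing γ (a.1.map (evalHom L μ)) : ℂ))

variable (f : ContMatrixAffineMap L K) (s : Finset (Matrix (Fin n) (Fin n) (affineFunctionSpace L)))

theorem compression_smul {r : ℕ+} (t : ℝ) (γ : Matrix (Fin r) (Fin n) ℂ) (μ : L.level r) :
    compression f s ((t : ℂ) • γ) μ = ((t ^ 2 : ℝ) : ℂ) • compression f s γ μ := by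
  refine Prod.ext ?_ (Prod.ext ?_ ?_)
  · exact sandwich_real_smul_left γ t _
  · change ((t : ℂ) • γ).conjTranspose * ((t : ℂ) • γ) =
      ((t ^ 2 : ℝ) : ℂ) • (γ.conjTranspose * γ)
    rw [Matrix.conjTranspose_smul, Matrix.smul_mul, Matrix.mul_smul, smul_smul, Complex.star_def,
      Complex.conj_ofReal, sq, Complex.ofReal_mul]
  · funext a
    change ((pairing ((t : ℂ) • γ) _ : ℝ) : ℂ) = ((t ^ 2 : ℝ) : ℂ) * (pairing γ _ : ℝ)
    rw [pairing_real_smul_left, Complex.ofReal_mul]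

/-- Matrix affinity, of `f` in the first coordinate and of the entries of each `a` in the last, lets
a matrix convex combination pass through the compression by `P`. -/
theorem sum_compression_mul {ι : Type*} [Fintype ι] {m : ℕ+} (size : ι → ℕ+)
    (u : ∀ i, Matrix (Fin (size i)) (Fin m) ℂ) (h : ∑ i, (u i).conjTranspose * u i = 1)
    (μ : ∀ i, L.level (size i)) (P : Matrix (Fin m) (Fin n) ℂ) :
    ∑ i, compression f s (u i * P) (μ i) =
      compression f s P ⟨_, L.sum_sandwich_mem size u h μ⟩ := by
  refine Prod.ext ?_ (Prod.ext ?_ ?_)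
  · rw [Prod.fst_sum]
    have h1 := f.affine.map_sum_sandwich size u h μ
    simp only [compression]
    rw [h1, sandwich_sum]
    exact Finset.sum_congr rfl fun i _ => (sandwich_sandwich _ _ _).symm
  · rw [Prod.snd_sum, Prod.fst_sum]
    simp only [compression]
    have h1 : ∀ i, (u i * P).conjTranspose * (u i * P) =
        P.conjTranspose * ((u i).conjTranspose * u i) * P := fun i => by
      rw [Matrix.conjTranspose_mul]
      simp only [Matrix.mul_assoc]
    calc _ = ∑ i, P.conjTranspose * ((u i).conjTranspose * u i) * P :=
          Finset.sum_congr rfl fun i _ => h1 i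
      _ = _ := by rw [← Matrix.sum_mul, ← Matrix.mul_sum, h, Matrix.mul_one]
  · rw [Prod.snd_sum, Prod.snd_sum]
    funext a
    rw [Finset.sum_apply]
    simp only [compression]
    rw [← Complex.ofReal_sum]
    congr 1
    have h1 : a.1.map (evalHom L ⟨_, L.sum_sandwich_mem size u h μ⟩) =
        ∑ i, (a.1.map (evalHom L (μ i))).map (sandwich (u i)) := by
      refine Matrix.ext fun k l => ?_
      rw [Matrix.sum_apply]
      exact (a.1 k l).2.affine.map_sum_sandwich size u h μ
    rw [h1, pairing_sum]
    exact Finset.sum_congr rfl fun i _ => pairing_mul _ _ _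

/-- Polar decomposition: a sum of compressions of total mass `D` invertible is one compression of a
point of `L_n`. -/
theorem exists_compression_eq_sum {ι : Type*} [Fintype ι] (size : ι → ℕ+)
    (δ : ∀ i, Matrix (Fin (size i)) (Fin n) ℂ) (μ : ∀ i, L.level (size i))
    (hD : IsUnit (∑ i, (δ i).conjTranspose * δ i)) :
    ∃ (P : Matrix (Fin n) (Fin n) ℂ) (μ' : L.level n),
      P.conjTranspose * P = ∑ i, (δ i).conjTranspose * δ i ∧
        compression f s P μ' = ∑ i, compression f s (δ i) (μ i) := by
  open scoped Matrix.Norms.L2Operator MatrixOrder ComplexOrder in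
  have hpos : 0 ≤ ∑ i, (δ i).conjTranspose * δ i := Finset.sum_nonneg fun i _ =>
    (Matrix.posSemidef_conjTranspose_mul_self (δ i)).nonneg
  open scoped Matrix.Norms.L2Operator MatrixOrder ComplexOrder in
  obtain ⟨P, hP⟩ := CStarAlgebra.nonneg_iff_eq_star_mul_self.1 hpos
  rw [Matrix.star_eq_conjTranspose] at hP
  have hPu : IsUnit P.det := by
    rw [hP, Matrix.isUnit_iff_isUnit_det, Matrix.det_mul] at hD
    exact isUnit_of_mul_isUnit_right hD
  -- With `P* P` equal to the total mass, the `δ_i P⁻¹` are coefficients of a matrix convex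
  -- combination; compressing the resulting point by `P` restores the `δ_i`.
  have hu : ∑ i, (δ i * P⁻¹).conjTranspose * (δ i * P⁻¹) = 1 := by
    have : ∀ i, (δ i * P⁻¹).conjTranspose * (δ i * P⁻¹) =
        P⁻¹.conjTranspose * ((δ i).conjTranspose * δ i) * P⁻¹ := fun i => by
      rw [Matrix.conjTranspose_mul]
      simp only [Matrix.mul_assoc]
    rw [Finset.sum_congr rfl fun i _ => this i, ← Matrix.sum_mul, ← Matrix.mul_sum, hP,
      Matrix.mul_assoc, Matrix.mul_assoc, Matrix.mul_nonsing_inv _ hPu, Matrix.mul_one,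
      ← Matrix.conjTranspose_mul, Matrix.mul_nonsing_inv _ hPu, Matrix.conjTranspose_one]
  refine ⟨P, ⟨_, L.sum_sandwich_mem size _ hu μ⟩, hP.symm, ?_⟩
  rw [← sum_compression_mul f s size _ hu]
  refine Finset.sum_congr rfl fun i _ => ?_
  rw [Matrix.mul_assoc, Matrix.nonsing_inv_mul _ hPu, Matrix.mul_one]

/-- The compressions of mass `n` of the points of `L_n`. -/
def compressionSet : Set (CompressionSpace W n s) :=
  {z | ∃ (P : Matrix (Fin n) (Fin n) ℂ) (μ : L.level n),
    (P.conjTranspose * P).trace = (n : ℕ) ∧ compression f s P μ = z}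

/-- The trace of `P* P` is the sum of the squared moduli of the entries of `P`, so every entry has
modulus at most `√k`. -/
theorem isCompact_setOf_trace_eq (m k : ℕ) :
    IsCompact {P : Matrix (Fin m) (Fin m) ℂ | (P.conjTranspose * P).trace = k} := by
  have hcl : IsClosed {P : Matrix (Fin m) (Fin m) ℂ | (P.conjTranspose * P).trace = k} :=
    isClosed_eq ((continuous_id.matrix_conjTranspose.matrix_mul continuous_id).matrix_trace)
      continuous_const
  have hK : IsCompact (Set.univ.pi fun _ : Fin m => Set.univ.pi fun _ : Fin m =>
      Metric.closedBall (0 : ℂ) √k) :=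
    isCompact_univ_pi fun _ => isCompact_univ_pi fun _ => isCompact_closedBall _ _
  refine IsCompact.of_isClosed_subset hK hcl fun P hP i _ j _ => ?_
  rw [mem_closedBall_zero_iff]
  refine Real.le_sqrt_of_sq_le ?_
  have h1 : ∑ j, ∑ i, ‖P i j‖ ^ 2 = (k : ℝ) := by
    have := congrArg Complex.re (show (P.conjTranspose * P).trace = k from hP)
    rw [Complex.natCast_re] at this
    rw [← this, Matrix.trace, Complex.re_sum]
    refine Finset.sum_congr rfl fun j _ => ?_
    rw [Matrix.diag_apply, Matrix.mul_apply, Complex.re_sum]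
    refine Finset.sum_congr rfl fun i _ => ?_
    rw [Matrix.conjTranspose_apply, Complex.star_def, mul_comm, Complex.mul_conj,
      Complex.ofReal_re, Complex.normSq_eq_norm_sq]
  rw [← h1]
  exact (Finset.single_le_sum (f := fun i => ‖P i j‖ ^ 2) (fun _ _ => by positivity)
    (Finset.mem_univ i)).trans (Finset.single_le_sum (f := fun j => ∑ i, ‖P i j‖ ^ 2)
      (fun _ _ => by positivity) (Finset.mem_univ j))

section Topology

variable [ContinuousAdd V] [ContinuousSMul ℂ V] [IsTopologicalAddGroup W] [ContinuousSMul ℂ W]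

theorem continuous_compression :
    Continuous fun p : Matrix (Fin n) (Fin n) ℂ × L.level n => compression f s p.1 p.2 := by
  have h0 : Continuous fun μ : L.level n => (f.toFun n μ : Matrix (Fin n) (Fin n) W) :=
    continuous_subtype_val.comp (f.continuous_toFun n)
  have h1 : Continuous fun p : Matrix (Fin n) (Fin n) ℂ × L.level n =>
      sandwich p.1 (f.toFun n p.2 : Matrix (Fin n) (Fin n) W) := by
    have hp : Continuous fun p : Matrix (Fin n) (Fin n) ℂ × L.level n =>
        (p.1, (f.toFun n p.2 : Matrix (Fin n) (Fin n) W)) :=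
      continuous_fst.prodMk (h0.comp continuous_snd)
    have := (continuous_sandwich (V := W) (m := n) (n := n)).comp hp
    exact this
  have h2 : Continuous fun p : Matrix (Fin n) (Fin n) ℂ × L.level n => p.1.conjTranspose * p.1 :=
    continuous_fst.matrix_conjTranspose.matrix_mul continuous_fst
  have h3 : ∀ a : Matrix (Fin n) (Fin n) (affineFunctionSpace L),
      Continuous fun p : Matrix (Fin n) (Fin n) ℂ × L.level n =>
        (pairing p.1 (a.map (evalHom L p.2)) : ℂ) := fun a => by
    refine Complex.continuous_ofReal.comp (Complex.continuous_re.comp ?_)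
    refine continuous_finsetSum _ fun k _ => continuous_finsetSum _ fun l _ => ?_
    have h4 : Continuous fun p : Matrix (Fin n) (Fin n) ℂ × L.level n => evalHom L p.2 (a k l) :=
      (continuous_evalHom (a k l)).comp continuous_snd
    exact (continuous_sandwich.comp (continuous_fst.prodMk h4)).matrix_elem k l
  exact h1.prodMk (h2.prodMk (continuous_pi fun a => h3 a.1))

theorem isCompact_compressionSet : IsCompact (compressionSet f s) := by
  have : CompactSpace (L.level n) := isCompact_iff_compactSpace.1 (L.isCompact_level n)
  have h := ((isCompact_setOf_trace_eq n n).prod (isCompact_univ (X := L.level n))).image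
    (continuous_compression f s)
  convert h using 1
  ext z
  simp only [compressionSet, Set.mem_ofPred_eq, Set.mem_image, Set.mem_prod, Set.mem_univ, and_true,
    Prod.exists]

variable [T2Space W]

/-- The total mass may be singular, so polar decomposition does not apply directly. Adding `ε` times
the compression of a point of `L_n` by `1` makes the mass invertible; renormalizing by `1 + ε`
restores the trace, and the limit `ε → 0` stays in the closed set. -/
theorem sum_compression_mem {ι : Type*} [Fintype ι] (size : ι → ℕ+)
    (δ : ∀ i, Matrix (Fin (size i)) (Fin n) ℂ) (μ : ∀ i, L.level (size i))
    (hD : (∑ i, (δ i).conjTranspose * δ i).trace = (n : ℕ)) :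
    ∑ i, compression f s (δ i) (μ i) ∈ compressionSet f s := by
  have hn : ((n : ℕ) : ℂ) ≠ 0 := Nat.cast_ne_zero.2 n.ne_zero
  -- An empty sum has trace `0 ≠ n`, so `L` has a point.
  obtain ⟨i₀⟩ : Nonempty ι := by
    by_contra h
    rw [not_nonempty_iff] at h
    rw [Finset.univ_eq_empty, Finset.sum_empty, Matrix.trace_zero] at hD
    exact hn hD.symm
  obtain ⟨μ₀⟩ := L.level_nonempty (μ i₀) n
  set z := ∑ i, compression f s (δ i) (μ i) with hz
  have hmem : ∀ ε : ℝ, 0 < ε →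
      (((1 + ε)⁻¹ : ℝ) : ℂ) • (z + (ε : ℂ) • compression f s 1 μ₀) ∈ compressionSet f s := by
    intro ε hε
    let size' : Option ι → ℕ+ := fun o => o.elim n size
    let δ' : ∀ o, Matrix (Fin (size' o)) (Fin n) ℂ := fun o =>
      match o with
      | none => (((√ε : ℝ) : ℂ) • (1 : Matrix (Fin n) (Fin n) ℂ))
      | some i => δ i
    let μ' : ∀ o, L.level (size' o) := fun o =>
      match o with
      | none => μ₀
      | some i => μ i
    have hsum : ∑ o, (δ' o).conjTranspose * δ' o =
        (ε : ℂ) • 1 + ∑ i, (δ i).conjTranspose * δ i := by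
      rw [Fintype.sum_option]
      congr 1
      change (((√ε : ℝ) : ℂ) • (1 : Matrix (Fin n) (Fin n) ℂ)).conjTranspose *
        (((√ε : ℝ) : ℂ) • (1 : Matrix (Fin n) (Fin n) ℂ)) = _
      rw [Matrix.conjTranspose_smul, Matrix.smul_mul, Matrix.mul_smul, smul_smul, Complex.star_def,
        Complex.conj_ofReal, ← Complex.ofReal_mul, Real.mul_self_sqrt hε.le,
        Matrix.conjTranspose_one, Matrix.mul_one]
    have hunit : IsUnit (∑ o, (δ' o).conjTranspose * δ' o) := by
      rw [hsum]
      open scoped ComplexOrder in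
      exact (((Matrix.PosDef.one (n := Fin n) (R := ℂ)).smul
        (a := (ε : ℂ)) (by exact_mod_cast hε)).add_posSemidef
        (Matrix.posSemidef_sum _ fun i _ => Matrix.posSemidef_conjTranspose_mul_self _)).isUnit
    obtain ⟨P, ν, hP, hPz⟩ := exists_compression_eq_sum f s size' δ' μ' hunit
    have h1 : 0 < 1 + ε := by linarith
    have ht : √(1 + ε)⁻¹ ^ 2 = (1 + ε)⁻¹ := Real.sq_sqrt (inv_nonneg.2 h1.le)
    refine ⟨((√(1 + ε)⁻¹ : ℝ) : ℂ) • P, ν, ?_, ?_⟩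
    · rw [Matrix.conjTranspose_smul, Matrix.smul_mul, Matrix.mul_smul, smul_smul, Complex.star_def,
        Complex.conj_ofReal, ← Complex.ofReal_mul, ← sq, ht, hP, hsum, Matrix.trace_smul,
        Matrix.trace_add, hD, Matrix.trace_smul, Matrix.trace_one, Fintype.card_fin]
      have : (1 + ε : ℂ) ≠ 0 := by exact_mod_cast h1.ne'
      push_cast
      simp only [smul_eq_mul]
      field_simp
      ring
    · have h2 := compression_smul f s √ε 1 μ₀
      rw [Real.sq_sqrt hε.le] at h2
      rw [compression_smul, ht, hPz, Fintype.sum_option, add_comm z]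
      exact congrArg (fun y => (((1 + ε)⁻¹ : ℝ) : ℂ) • (y + z)) h2
  have hlim : Filter.Tendsto (fun ε : ℝ =>
      (((1 + ε)⁻¹ : ℝ) : ℂ) • (z + (ε : ℂ) • compression f s 1 μ₀))
      (nhdsWithin 0 (Set.Ioi 0)) (nhds z) := by
    have hc : ContinuousAt (fun ε : ℝ =>
        (((1 + ε)⁻¹ : ℝ) : ℂ) • (z + (ε : ℂ) • compression f s 1 μ₀)) 0 := by
      have h1 : ContinuousAt (fun ε : ℝ => (((1 + ε)⁻¹ : ℝ) : ℂ)) 0 :=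
        Complex.continuous_ofReal.continuousAt.comp
          ((continuousAt_const.add continuousAt_id).inv₀ (by simp))
      have h2 : Continuous fun ε : ℝ => z + (ε : ℂ) • compression f s 1 μ₀ :=
        continuous_const.add (Complex.continuous_ofReal.smul continuous_const)
      exact h1.smul h2.continuousAt
    have h0 := hc.tendsto.mono_left (nhdsWithin_le_nhds (s := Set.Ioi 0))
    simpa using h0
  exact (isCompact_compressionSet f s).isClosed.mem_of_tendsto hlim
    (Filter.eventually_of_mem self_mem_nhdsWithin hmem)

/-- Compressions are quadratic in `γ`, so the weights `a`, `b` are absorbed as `√a`, `√b` into the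
two matrices. -/
theorem convex_compressionSet : Convex ℝ (compressionSet f s) := by
  rintro _ ⟨P, μ, hP, rfl⟩ _ ⟨Q, ν, hQ, rfl⟩ a b ha hb hab
  have h := sum_compression_mem f s (ι := Fin 2) (fun _ => n)
    ![((√a : ℝ) : ℂ) • P, ((√b : ℝ) : ℂ) • Q] ![μ, ν] (by
      simp only [Fin.sum_univ_two, Matrix.cons_val_zero, Matrix.cons_val_one,
        Matrix.conjTranspose_smul, Matrix.smul_mul, Matrix.mul_smul, smul_smul, Complex.star_def,
        Complex.conj_ofReal, ← Complex.ofReal_mul, Real.mul_self_sqrt ha, Real.mul_self_sqrt hb,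
        Matrix.trace_add, Matrix.trace_smul, hP, hQ, smul_eq_mul]
      rw [← add_mul, ← Complex.ofReal_add, hab, Complex.ofReal_one, one_mul])
  simp only [Fin.sum_univ_two, Matrix.cons_val_zero, Matrix.cons_val_one] at h
  rw [compression_smul, compression_smul, Real.sq_sqrt ha, Real.sq_sqrt hb, Complex.coe_smul,
    Complex.coe_smul] at h
  exact h

end Topology

end Separation

/-! ### Separation by matrices over `A(K)` -/

section SeparationTheorem

universe v w

variable {V : Type v} [AddCommGroup V] [Module ℂ V] [TopologicalSpace V]
  {W : Type w} [AddCommGroup W] [Module ℂ W] [TopologicalSpace W]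
  {L : CompactMatrixConvexSet V} {K : CompactMatrixConvexSet W} {n : ℕ+}

theorem exists_functional_apply_eq {S : Type*} [Fintype S] (g : CompressionSpace W n S →L[ℂ] ℂ) :
    ∃ (F : Fin n → Fin n → W →L[ℂ] ℂ) (z : Matrix (Fin n) (Fin n) ℂ) (t : S → ℂ),
      ∀ (w : Matrix (Fin n) (Fin n) W) (y : Matrix (Fin n) (Fin n) ℂ) (p : S → ℂ),
        g (w, y, p) = ∑ k, ∑ l, (F k l (w k l) + y k l * z k l) + ∑ a, p a * t a := by
  classical
  refine ⟨fun k l => g.comp ((ContinuousLinearMap.inl ℂ _ _).comp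
      ((ContinuousLinearMap.single ℂ (fun _ : Fin n => Fin n → W) k).comp
        (ContinuousLinearMap.single ℂ (fun _ : Fin n => W) l))),
    fun k l => g (0, Pi.single k (Pi.single l 1), 0), fun a => g (0, 0, Pi.single a 1),
    fun w y p => ?_⟩
  change g (w, y, p) = ∑ k, ∑ l, (g (Pi.single k (Pi.single l (w k l)), 0, 0) +
      y k l * g (0, Pi.single k (Pi.single l 1), 0)) + ∑ a, p a * g (0, 0, Pi.single a 1)
  have h : ((w, y, p) : CompressionSpace W n S) = ∑ k, ∑ l, ((Pi.single k (Pi.single l (w k l)), 0, 0) +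
      y k l • (0, Pi.single k (Pi.single l 1), 0)) +
        ∑ a, p a • ((0, 0, Pi.single a 1) : CompressionSpace W n S) := by
    refine Prod.ext ?_ (Prod.ext ?_ ?_)
    · simp only [Prod.fst_add, Prod.fst_sum, Prod.smul_fst, smul_zero, add_zero,
        Finset.sum_const_zero]
      funext k l
      simp [Finset.sum_apply, Pi.single_apply, ite_apply]
    · simp only [Prod.fst_add, Prod.snd_add, Prod.fst_sum, Prod.snd_sum, Prod.smul_fst,
        Prod.smul_snd, smul_zero, add_zero, zero_add, Finset.sum_const_zero]
      funext k l
      simp [Finset.sum_apply, Pi.single_apply, apply_ite, ite_apply]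
    · simp only [Prod.snd_add, Prod.snd_sum, Prod.smul_snd, smul_zero, add_zero, zero_add,
        Finset.sum_const_zero]
      funext a
      simp [Finset.sum_apply, Pi.single_apply]
  refine (congrArg g h).trans ?_
  simp only [map_add, map_sum, map_smul, smul_eq_mul]

/-- Continuous functionals on `M_n(W) × M_n(ℂ)` are given by elements of `M_n(A(K))`. -/
theorem exists_pairing_eq (K : CompactMatrixConvexSet W) (F : Fin n → Fin n → W →L[ℂ] ℂ)
    (z : Matrix (Fin n) (Fin n) ℂ) :
    ∃ b : Matrix (Fin n) (Fin n) (affineFunctionSpace K),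
      ∀ (r : ℕ+) (ν : K.level r) (γ : Matrix (Fin r) (Fin n) ℂ),
        pairing γ (b.map (evalHom K ν)) =
          (∑ k, ∑ l, (F k l (sandwich γ (ν : Matrix (Fin r) (Fin r) W) k l) +
            (γ.conjTranspose * γ) k l * z k l)).re := by
  choose x hx using fun k l => exists_evalHom_eq_map_add_smul_one K (F k l) (z k l)
  refine ⟨Matrix.of x, fun r ν γ => ?_⟩
  rw [pairing]
  congr 1
  refine Finset.sum_congr rfl fun k _ => Finset.sum_congr rfl fun l _ => ?_
  have h1 := congrFun (congrFun (sandwich_map (F k l : W →ₗ[ℂ] ℂ) γ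
    (ν : Matrix (Fin r) (Fin r) W)) k) l
  rw [ContinuousLinearMap.coe_coe] at h1
  rw [Matrix.map_apply, Matrix.of_apply, hx, sandwich_add, sandwich_smul, sandwich_complex γ 1,
    Matrix.mul_one, Matrix.add_apply, ← h1, Matrix.map_apply, Matrix.smul_apply, smul_eq_mul,
    mul_comm (z k l)]

theorem exists_separating_functional [IsTopologicalAddGroup W] [ContinuousSMul ℂ W]
    [LocallyConvexSpace ℝ W] [T2Space W] [ContinuousAdd V] [ContinuousSMul ℂ V]
    (f : ContMatrixAffineMap L K) (s : Finset (Matrix (Fin n) (Fin n) (affineFunctionSpace L)))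
    (ν : K.level n)
    (hν : ∀ μ : L.level n, f.toFun n μ = ν → ∃ a ∈ s, pairing 1 (a.map (evalHom L μ)) < 0) :
    ∃ (g : CompressionSpace W n s →L[ℂ] ℂ) (u v : ℝ), (∀ x ∈ compressionSet f s, (g x).re < u) ∧
      u < v ∧ ∀ p : s → ℝ, (∀ a, 0 ≤ p a) → v < (g (((ν : Matrix (Fin n) (Fin n) W),
        (1 : Matrix (Fin n) (Fin n) ℂ), fun a => (p a : ℂ)) : CompressionSpace W n s)).re := by
  -- These are the triples that a lift of `ν` with all forms nonnegative would produce.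
  let N : Set (CompressionSpace W n s) :=
    {z | z.1 = (ν : Matrix (Fin n) (Fin n) W) ∧ z.2.1 = (1 : Matrix (Fin n) (Fin n) ℂ) ∧
      ∀ a, 0 ≤ (z.2.2 a).re}
  have hNconv : Convex ℝ N := by
    rintro z ⟨hz1, hz2, hz3⟩ z' ⟨hz1', hz2', hz3'⟩ α β hα hβ hαβ
    refine ⟨?_, ?_, fun a => ?_⟩
    · rw [Prod.fst_add, Prod.smul_fst, Prod.smul_fst, hz1, hz1']
      exact Convex.combo_self hαβ _
    · rw [Prod.snd_add, Prod.smul_snd, Prod.smul_snd, Prod.fst_add, Prod.smul_fst, Prod.smul_fst,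
        hz2, hz2']
      exact Convex.combo_self hαβ _
    · have : ((α • z + β • z').2.2 a).re = α * (z.2.2 a).re + β * (z'.2.2 a).re := by
        simp
      rw [this]
      exact add_nonneg (mul_nonneg hα (hz3 a)) (mul_nonneg hβ (hz3' a))
  have hNclosed : IsClosed N := by
    have h : IsClosed {z : CompressionSpace W n s | ∀ a, 0 ≤ (z.2.2 a).re} := by
      rw [Set.ofPred_forall]
      exact isClosed_iInter fun a => isClosed_le continuous_const (Complex.continuous_re.comp
        ((continuous_apply a).comp (continuous_snd.comp continuous_snd)))
    exact (isClosed_eq continuous_fst continuous_const).inter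
      ((isClosed_eq (continuous_fst.comp continuous_snd) continuous_const).inter h)
  have hdisj : Disjoint (compressionSet f s) N := by
    rw [Set.disjoint_left]
    rintro _ ⟨P, μ, -, rfl⟩ ⟨h1, h2, h3⟩
    -- Mass exactly `1` allows `P` to be used as a single coefficient, so `P* μ P` is a point of
    -- `L_n` over `ν`, where some form in `s` is negative.
    have hP : P.conjTranspose * P = 1 := h2
    obtain ⟨a, ha, hlt⟩ := hν ⟨_, L.sandwich_mem P hP μ⟩
      (Subtype.ext ((f.affine.map_sandwich P hP μ).trans h1))
    have h4 : 0 ≤ pairing P (a.map (evalHom L μ)) := h3 ⟨a, ha⟩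
    rw [← Matrix.mul_one P, pairing_mul] at h4
    have h5 : a.map (evalHom L ⟨_, L.sandwich_mem P hP μ⟩) =
        (a.map (evalHom L μ)).map (sandwich P) :=
      Matrix.ext fun k l => (a k l).2.affine.map_sandwich P hP μ
    rw [h5] at hlt
    exact absurd h4 (not_le.2 hlt)
  obtain ⟨g, u, v, hgu, huv, hgv⟩ := RCLike.geometric_hahn_banach_compact_closed (𝕜 := ℂ)
    (convex_compressionSet f s) (isCompact_compressionSet f s) hNconv hNclosed hdisj
  exact ⟨g, u, v, hgu, huv, fun p hp => hgv _ ⟨rfl, rfl, hp⟩⟩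

/-- Both sides are homogeneous of degree two in `γ`. If `γ = 0` they vanish; otherwise `γ` is
rescaled to mass of trace `n`, and `sum_compression_mem` with one term carries the point from `L_r`
into the compression set. -/
theorem re_le_of_forall_compressionSet_lt [IsTopologicalAddGroup W] [ContinuousSMul ℂ W]
    [T2Space W] [ContinuousAdd V] [ContinuousSMul ℂ V]
    (f : ContMatrixAffineMap L K) (s : Finset (Matrix (Fin n) (Fin n) (affineFunctionSpace L)))
    (g : CompressionSpace W n s →L[ℂ] ℂ) {u : ℝ} (hgu : ∀ x ∈ compressionSet f s, (g x).re < u)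
    {r : ℕ+} (μ : L.level r) (γ : Matrix (Fin r) (Fin n) ℂ) :
    (g (compression f s γ μ)).re ≤ u / (n : ℕ) * (γ.conjTranspose * γ).trace.re := by
  have hn : (0 : ℝ) < (n : ℕ) := Nat.cast_pos.2 n.pos
  open scoped ComplexOrder in
  have hpos := (Matrix.posSemidef_conjTranspose_mul_self γ).trace_nonneg
  rw [Complex.nonneg_iff] at hpos
  set d := (γ.conjTranspose * γ).trace.re with hd
  have htr : (γ.conjTranspose * γ).trace = (d : ℂ) :=
    Complex.ext rfl (by rw [← hpos.2, Complex.ofReal_im])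
  rcases hpos.1.eq_or_lt with h0 | h0
  · have hγ : γ = 0 := by
      open scoped ComplexOrder in
      exact Matrix.trace_conjTranspose_mul_self_eq_zero_iff.1
        (by rw [htr, ← h0, Complex.ofReal_zero])
    have h1 := compression_smul f s 0 γ μ
    rw [hγ, smul_zero, zero_pow two_ne_zero, Complex.ofReal_zero, zero_smul] at h1
    rw [hγ, h1, ← h0, map_zero, Complex.zero_re, mul_zero]
  · have h1 : 0 ≤ (n : ℕ) / d := by positivity
    have h2 := hgu _ (sum_compression_mem f s (ι := Unit) (fun _ => r)
      (fun _ => ((√((n : ℕ) / d) : ℝ) : ℂ) • γ) (fun _ => μ) (by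
        rw [Finset.univ_unique, Finset.sum_singleton, Matrix.conjTranspose_smul,
          Matrix.smul_mul, Matrix.mul_smul, smul_smul, Complex.star_def, Complex.conj_ofReal,
          ← Complex.ofReal_mul, Real.mul_self_sqrt h1, Matrix.trace_smul, htr, smul_eq_mul,
          ← Complex.ofReal_mul, div_mul_cancel₀ _ h0.ne', Complex.ofReal_natCast]))
    rw [Finset.univ_unique, Finset.sum_singleton, compression_smul, Real.sq_sqrt h1, map_smul,
      smul_eq_mul, Complex.re_ofReal_mul] at h2
    have h3 := mul_lt_mul_of_pos_left h2 (div_pos h0 hn)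
    rw [← mul_assoc, div_mul_div_cancel₀ hn.ne', div_self h0.ne', one_mul] at h3
    calc _ ≤ _ := h3.le
      _ = _ := by ring
/-- If `ν ∈ K_n` is not the image of a point of `L_n` at which the functions in `s` have nonnegative
quadratic form at the identity, then some `b ∈ M_n(A(K))` separates `ν` from the image of these
points. -/
theorem exists_separating_affineFunction [IsTopologicalAddGroup W] [ContinuousSMul ℂ W]
    [LocallyConvexSpace ℝ W] [T2Space W] [ContinuousAdd V] [ContinuousSMul ℂ V]
    (f : ContMatrixAffineMap L K) (s : Finset (Matrix (Fin n) (Fin n) (affineFunctionSpace L)))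
    (ν : K.level n)
    (hν : ∀ μ : L.level n, f.toFun n μ = ν → ∃ a ∈ s, pairing 1 (a.map (evalHom L μ)) < 0) :
    ∃ (b : Matrix (Fin n) (Fin n) (affineFunctionSpace K)) (t : s → ℝ), (∀ a, 0 ≤ t a) ∧
      (∀ (r : ℕ+) (μ : L.level r) (γ : Matrix (Fin r) (Fin n) ℂ),
        ∑ a, t a * pairing γ (a.1.map (evalHom L μ)) ≤
          pairing γ (b.map (evalHom K (f.toFun r μ)))) ∧
      pairing 1 (b.map (evalHom K ν)) < 0 := by
  classical
  obtain ⟨g, u, v, hgu, huv, hgv⟩ := exists_separating_functional f s ν hν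
  obtain ⟨F, z, H, hg⟩ := exists_functional_apply_eq g
  let c : ℝ := u / (n : ℕ)
  -- The matrix `b` represents `c tr(γ* γ)` minus the part of `g` on the first two coordinates. The
  -- coefficients of `g` on the last coordinates give `t_a = Re H_a`.
  obtain ⟨b, hb⟩ := exists_pairing_eq K (fun k l => -F k l) ((c : ℂ) • 1 - z)
  have hpair : ∀ (r : ℕ+) (ν : K.level r) (γ : Matrix (Fin r) (Fin n) ℂ) (p : s → ℝ),
      pairing γ (b.map (evalHom K ν)) = c * (γ.conjTranspose * γ).trace.re -
        (g ((sandwich γ (ν : Matrix (Fin r) (Fin r) W), γ.conjTranspose * γ,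
          fun a => (p a : ℂ)) : CompressionSpace W n s)).re + ∑ a, (H a).re * p a := by
    intro r ν γ p
    have h3 : ∑ k, ∑ l, (γ.conjTranspose * γ) k l * (1 : Matrix (Fin n) (Fin n) ℂ) k l =
        (γ.conjTranspose * γ).trace := by
      simp [Matrix.one_apply, Matrix.trace]
    have h4 : (∑ a, (p a : ℂ) * H a).re = ∑ a, (H a).re * p a := by
      rw [Complex.re_sum]
      refine Finset.sum_congr rfl fun a _ => ?_
      rw [Complex.re_ofReal_mul, mul_comm]
    have h5 : ∑ k, ∑ l, ((-F k l) (sandwich γ (ν : Matrix (Fin r) (Fin r) W) k l) +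
        (γ.conjTranspose * γ) k l * ((c : ℂ) • (1 : Matrix (Fin n) (Fin n) ℂ) - z) k l) =
        (c : ℂ) * (γ.conjTranspose * γ).trace -
          ∑ k, ∑ l, (F k l (sandwich γ (ν : Matrix (Fin r) (Fin r) W) k l) +
            (γ.conjTranspose * γ) k l * z k l) := by
      rw [← h3]
      simp only [Finset.mul_sum, ← Finset.sum_sub_distrib]
      refine Finset.sum_congr rfl fun k _ => Finset.sum_congr rfl fun l _ => ?_
      rw [neg_apply, Matrix.sub_apply, Matrix.smul_apply, smul_eq_mul]
      ring
    have h6 := hg (sandwich γ (ν : Matrix (Fin r) (Fin r) W)) (γ.conjTranspose * γ)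
      fun a => (p a : ℂ)
    rw [hb, h5, h6, Complex.sub_re, Complex.add_re, h4, Complex.re_ofReal_mul]
    ring
  have hn : (0 : ℝ) < (n : ℕ) := Nat.cast_pos.2 n.pos
  have hN : ∀ p : s → ℝ, (∀ a, 0 ≤ p a) → v < u - pairing 1 (b.map (evalHom K ν)) +
      ∑ a, (H a).re * p a := fun p hp => by
    have h1 := hgv p hp
    have h2 := hpair n ν 1 p
    have h3 : c * (1 : Matrix (Fin n) (Fin n) ℂ).trace.re = u := by
      rw [Matrix.trace_one, Fintype.card_fin, Complex.natCast_re, div_mul_cancel₀ _ hn.ne']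
    rw [Matrix.conjTranspose_one, Matrix.one_mul, sandwich_one, h3] at h2
    linarith
  refine ⟨b, fun a => (H a).re, fun a => ?_, fun r μ γ => ?_, ?_⟩
  -- If `t_a < 0`, the lower bound `v` fails along the ray in direction `a`; the chosen `τ` solves
  -- `q + t_a τ = v`.
  · by_contra hta
    push Not at hta
    set q := u - pairing 1 (b.map (evalHom K ν))
    have h1 : ∀ τ : ℝ, 0 ≤ τ → v < q + (H a).re * τ := fun τ hτ => by
      have h2 := hN (Pi.single a τ) fun a' => by
        by_cases h : a' = a
        · subst h
          rwa [Pi.single_eq_same]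
        · rw [Pi.single_eq_of_ne h]
      simpa only [Pi.single_apply, mul_ite, mul_zero, Finset.sum_ite_eq', Finset.mem_univ,
        if_true] using h2
    have h0 := h1 0 le_rfl
    rw [mul_zero, add_zero] at h0
    have h2 := h1 ((q - v) / (-(H a).re)) (div_nonneg (by linarith) (by linarith))
    have h3 : (H a).re * ((q - v) / (-(H a).re)) = -(q - v) := by
      have : (H a).re ≠ 0 := hta.ne
      field_simp
    linarith
  -- With `p` the actual values of the forms at `μ`, the argument of `g` is a compression, where `c
  -- tr(γ* γ)` bounds `Re g`.
  · have h1 := hpair r (f.toFun r μ) γ fun a => pairing γ (a.1.map (evalHom L μ))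
    have h2 := re_le_of_forall_compressionSet_lt f s g hgu μ γ
    change _ ≤ c * _ at h2
    rw [compression] at h2
    linarith
  · have h1 := hN 0 fun _ => le_rfl
    simp only [Pi.zero_apply, mul_zero, Finset.sum_const_zero, add_zero] at h1
    linarith

end SeparationTheorem

/-! ### Passing to hermitian parts -/

section Symmetrize

universe u v

theorem OperatorSystem.adj_add (S : OperatorSystem.{u}) (x y : S.carrier) :
    S.adj (x + y) = S.adj x + S.adj y := Subtype.ext (star_add _ _)

theorem OperatorSystem.adj_adj (S : OperatorSystem.{u}) (x : S.carrier) :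
    S.adj (S.adj x) = x := Subtype.ext (star_star _)

theorem OperatorSystem.adj_sub (S : OperatorSystem.{u}) (x y : S.carrier) :
    S.adj (x - y) = S.adj x - S.adj y := Subtype.ext (star_sub _ _)

theorem OperatorSystem.adj_sum_real_smul (S : OperatorSystem.{u}) {ι : Type*} [Fintype ι]
    (t : ι → ℝ) (x : ι → S.carrier) :
    S.adj (∑ i, (t i : ℂ) • x i) = ∑ i, (t i : ℂ) • S.adj (x i) := by
  refine Subtype.ext ?_
  simp only [OperatorSystem.coe_adj, Submodule.coe_sum, Submodule.coe_smul, star_sum, star_smul,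
    Complex.star_def, Complex.conj_ofReal]

variable {V : Type v} [AddCommGroup V] [Module ℂ V] [TopologicalSpace V]
  {K : CompactMatrixConvexSet V} {n : ℕ}

/-- The adjoint on `A(K)`. -/
noncomputable def affineAdj (x : affineFunctionSpace K) : affineFunctionSpace K :=
  (affineFunctions K).adj x

/-- Twice the real part of a matrix over `A(K)`. -/
noncomputable def symmetrize (a : Matrix (Fin n) (Fin n) (affineFunctionSpace K)) :
    Matrix (Fin n) (Fin n) (affineFunctionSpace K) :=
  Matrix.of fun i j => a i j + affineAdj (a j i)

theorem adj_symmetrize (a : Matrix (Fin n) (Fin n) (affineFunctionSpace K)) (i j : Fin n) :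
    (affineFunctions K).adj (symmetrize a i j) = symmetrize a j i :=
  ((affineFunctions K).adj_add (a i j) ((affineFunctions K).adj (a j i))).trans
    ((congrArg _ ((affineFunctions K).adj_adj (a j i))).trans (add_comm _ _))

theorem pairing_symmetrize {r : ℕ+} (γ : Matrix (Fin r) (Fin n) ℂ)
    (a : Matrix (Fin n) (Fin n) (affineFunctionSpace K)) (ν : K.level r) :
    pairing γ ((symmetrize a).map (evalHom K ν)) = 2 * pairing γ (a.map (evalHom K ν)) := by
  have h : (symmetrize a).map (evalHom K ν) =
      a.map (evalHom K ν) + (a.map (evalHom K ν)).conjTranspose := rfl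
  rw [h, pairing_add, pairing_conjTranspose, two_mul]

/-- Separation controls only real parts of forms, whereas positivity also requires self-adjointness;
symmetrizing supplies it and merely doubles the form. -/
theorem isPositive_symmetrize {a : Matrix (Fin n) (Fin n) (affineFunctionSpace K)}
    (h : ∀ (r : ℕ+) (ν : K.level r) (γ : Matrix (Fin r) (Fin n) ℂ),
      0 ≤ pairing γ (a.map (evalHom K ν))) :
    (affineFunctions K).IsPositive (symmetrize a) :=
  (isPositive_affineFunctions_iff _).2 ⟨adj_symmetrize a, fun r ν γ =>
    (mul_nonneg two_pos.le (h r ν γ)).trans_eq (pairing_symmetrize γ a ν).symm⟩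

end Symmetrize

/-! ### Essential extensions come from boundaries -/

section Restriction

universe v w

variable {G : Type*} [Group G] {V : Type v} [AddCommGroup V] [Module ℂ V] [TopologicalSpace V]
  {W : Type w} [AddCommGroup W] [Module ℂ W] [TopologicalSpace W]

/-- The inclusion of a compact matrix convex subset. -/
def ContMatrixAffineMap.inclusion {L' L : CompactMatrixConvexSet V}
    (hsub : ∀ n, L'.level n ⊆ L.level n) : ContMatrixAffineMap L' L where
  toFun n := Set.inclusion (hsub n)
  continuous_toFun n := continuous_inclusion (hsub n)
  affine _ _ _ := rfl

/-- The restriction of a matrix affine map to a compact matrix convex subset. -/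
def ContMatrixAffineMap.restrict {L : CompactMatrixConvexSet V} {K : CompactMatrixConvexSet W}
    (f : ContMatrixAffineMap L K) {L' : CompactMatrixConvexSet V}
    (hsub : ∀ n, L'.level n ⊆ L.level n) : ContMatrixAffineMap L' K where
  toFun n μ := f.toFun n (Set.inclusion (hsub n) μ)
  continuous_toFun n := (f.continuous_toFun n).comp (continuous_inclusion (hsub n))
  affine n c μ := f.affine n c fun i => Set.inclusion (hsub _) (μ i)

/-- The restriction of a matrix affine dynamical system to an invariant subset. -/
def MatrixAffineSystem.restrict (L : MatrixAffineSystem G V) (L' : CompactMatrixConvexSet V)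
    (hsub : ∀ n, L'.level n ⊆ L.level n)
    (hinv : ∀ (s : G) (n : ℕ+) (μ : L.level n), (μ : Matrix (Fin n) (Fin n) V) ∈ L'.level n →
      (L.act s n μ : Matrix (Fin n) (Fin n) V) ∈ L'.level n) : MatrixAffineSystem G V where
  toCompactMatrixConvexSet := L'
  act :=
    { toFun := fun s n =>
        { toFun := fun μ => ⟨L.act s n (Set.inclusion (hsub n) μ), hinv s n _ μ.2⟩
          invFun := fun μ => ⟨L.act s⁻¹ n (Set.inclusion (hsub n) μ), hinv s⁻¹ n _ μ.2⟩
          left_inv := fun μ => Subtype.ext (by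
            change ((L.act s⁻¹ n (L.act s n (Set.inclusion (hsub n) μ)) : L.level n) :
              Matrix (Fin n) (Fin n) V) = μ
            rw [map_inv]
            exact congrArg Subtype.val ((L.act s n).symm_apply_apply _))
          right_inv := fun μ => Subtype.ext (by
            change ((L.act s n (L.act s⁻¹ n (Set.inclusion (hsub n) μ)) : L.level n) :
              Matrix (Fin n) (Fin n) V) = μ
            rw [map_inv]
            exact congrArg Subtype.val ((L.act s n).apply_symm_apply _))
          continuous_toFun := (continuous_subtype_val.comp
            ((L.act s n).continuous.comp (continuous_inclusion (hsub n)))).subtype_mk _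
          continuous_invFun := (continuous_subtype_val.comp
            ((L.act s⁻¹ n).continuous.comp (continuous_inclusion (hsub n)))).subtype_mk _ }
      map_one' := by
        funext n
        ext1 μ
        apply Subtype.ext
        change ((L.act 1 n (Set.inclusion (hsub n) μ) : L.level n) :
          Matrix (Fin n) (Fin n) V) = μ
        rw [map_one]
        rfl
      map_mul' := fun s t => by
        funext n
        ext1 μ
        apply Subtype.ext
        change ((L.act (s * t) n (Set.inclusion (hsub n) μ) : L.level n) :
          Matrix (Fin n) (Fin n) V) = L.act s n (L.act t n (Set.inclusion (hsub n) μ))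
        rw [map_mul]
        rfl }
  act_affine s n c μ := L.act_affine s n c fun i => Set.inclusion (hsub _) (μ i)

/-- An essential extension of function systems comes from a boundary. -/
theorem IsEssentialExtension.isBoundary [IsTopologicalAddGroup V] [ContinuousSMul ℂ V]
    [LocallyConvexSpace ℝ V] [T2Space V] {L : MatrixAffineSystem G V} {K : MatrixAffineSystem G W}
    {f : ContMatrixAffineMap L.toCompactMatrixConvexSet K.toCompactMatrixConvexSet}
    (hsurj : ∀ n, Function.Surjective (f.toFun n)) (hequiv : IsEquivariant L K f)
    (hess : IsEssentialExtension (affineFunctionSystem K) (affineFunctionSystem L) f.pullback) :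
    IsBoundary L K f := by
  refine ⟨hsurj, fun L' hsub hinv hsurj' n => (hsub n).antisymm fun ν hν => ?_⟩
  by_contra hν'
  let R := L.restrict L' hsub hinv
  let j : ContMatrixAffineMap L' L.toCompactMatrixConvexSet := .inclusion hsub
  -- This is restriction to `L'` composed with the pullback along `f`; it is an embedding because
  -- `f(L') = K`.
  have hcomp : IsEmbedding (affineFunctionSystem K) (affineFunctionSystem R)
      (f.restrict hsub).pullback := by
    refine IsEquivariant.isEmbedding_pullback (L := R) (fun s n μ => hequiv s n _) fun n ν => ?_
    obtain ⟨μ, hμ, h⟩ := hsurj' n ν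
    exact ⟨⟨μ, hμ⟩, h⟩
  have hj : IsMorphism (affineFunctionSystem L) (affineFunctionSystem R) j.pullback :=
    ⟨j.pullback_ucp, fun s x => evalHom_ext fun r μ => rfl⟩
  have hemb := hess.essential (affineFunctionSystem R) j.pullback hj hcomp
  -- Separation for the inclusion `j`: the fibre over `ν` is empty, so no forms are needed, and `b`
  -- is nonnegative on `L'` but negative at `ν`.
  obtain ⟨b, t, -, hb, hbν⟩ := exists_separating_affineFunction j ∅ ⟨ν, hν⟩
    fun μ hμ => by
      have h : (μ : Matrix (Fin n) (Fin n) V) = ν := congrArg Subtype.val hμ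
      exact absurd μ.2 (h ▸ hν')
  have hpos : (affineFunctions L').IsPositive
      (symmetrize (b.map j.pullback)) :=
    isPositive_symmetrize fun r μ γ => le_trans (by simp) (hb r μ γ)
  have h := (isPositive_affineFunctions_iff _).1
    (hemb.reflects_positive n (symmetrize b) hpos)
  have h1 := h.2 n ⟨ν, hν⟩ 1
  rw [pairing_symmetrize] at h1
  linarith

end Restriction

/-! ### Boundaries give essential extensions -/

section Boundary

universe u v w

variable {V : Type v} [AddCommGroup V] [Module ℂ V] [TopologicalSpace V]
  {W : Type w} [AddCommGroup W] [Module ℂ W] [TopologicalSpace W]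
  {L : CompactMatrixConvexSet V} {K : CompactMatrixConvexSet W} {R : OperatorSystem.{u}}

/-- The points of `L_n` at which all matrices of affine functions with positive image under `φ` are
positive. -/
def positivitySet (φ : affineFunctionSpace L →ₗ[ℂ] R.carrier) (n : ℕ+) : Set (L.level n) :=
  {μ | ∀ a : Matrix (Fin n) (Fin n) (affineFunctionSpace L), R.IsPositive (a.map φ) →
    0 ≤ pairing 1 (a.map (evalHom L μ))}

/-- A matrix `γ` can be moved to the outer index, replacing `a` by its compression by the transpose
of `γ`. This has size `n` and still has positive image, so the single test vector `1` in size `n`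
suffices. -/
theorem mem_positivitySet_iff {φ : affineFunctionSpace L →ₗ[ℂ] R.carrier} {n : ℕ+}
    {μ : L.level n} : μ ∈ positivitySet φ n ↔
      ∀ (m : ℕ) (a : Matrix (Fin m) (Fin m) (affineFunctionSpace L)), R.IsPositive (a.map φ) →
        ∀ γ : Matrix (Fin n) (Fin m) ℂ, 0 ≤ pairing γ (a.map (evalHom L μ)) := by
  refine ⟨fun h m a ha γ => ?_, fun h a ha => h n a ha 1⟩
  have h1 := h (sandwich γ.transpose a) (by rw [sandwich_map]; exact ha.sandwich _)
  rwa [sandwich_map, pairing_sandwich, Matrix.transpose_transpose, Matrix.one_mul] at h1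

theorem eq_zero_of_forall_mem_positivitySet {φ : affineFunctionSpace L →ₗ[ℂ] R.carrier}
    (huniv : ∀ (n : ℕ+) (μ : L.level n), μ ∈ positivitySet φ n) {x : affineFunctionSpace L}
    (hx : φ x = 0) : x = 0 := by
  refine evalHom_ext fun n μ => ?_
  set N := evalHom L μ x with hN
  -- Every scalar matrix multiple of `x` has image `0`, which is positive. These coefficients make
  -- the form equal to `-∑ |N_{kl}|²`, forcing `N = 0`.
  let a : Matrix (Fin n) (Fin n) (affineFunctionSpace L) :=
    Matrix.of fun k l => (-star (N k l)) • x
  have ha : a.map φ = 0 := Matrix.ext fun k l =>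
    (map_smul φ (-star (N k l)) x).trans (by rw [hx, smul_zero]; rfl)
  have h := huniv n μ a (by rw [ha]; exact OperatorSystem.isPositive_zero)
  have h1 : pairing 1 (a.map (evalHom L μ)) =
      -∑ k, ∑ l, Complex.normSq (N k l) := by
    simp only [pairing, sandwich_one, Matrix.map_apply, a, Matrix.of_apply, map_smul,
      Matrix.smul_apply, smul_eq_mul, ← hN, Complex.re_sum, ← Finset.sum_neg_distrib]
    refine Finset.sum_congr rfl fun k _ => Finset.sum_congr rfl fun l _ => ?_
    rw [neg_mul, Complex.star_def, mul_comm, Complex.mul_conj, Complex.neg_re, Complex.ofReal_re]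
  rw [h1, neg_nonneg] at h
  have h2 := le_antisymm h (Finset.sum_nonneg fun k _ => Finset.sum_nonneg fun l _ =>
    Complex.normSq_nonneg (N k l))
  rw [map_zero]
  refine Matrix.ext fun k l => ?_
  have h3 := (Finset.sum_eq_zero_iff_of_nonneg fun k _ => Finset.sum_nonneg fun l _ =>
    Complex.normSq_nonneg (N k l)).1 h2 k (Finset.mem_univ k)
  exact Complex.normSq_eq_zero.1 ((Finset.sum_eq_zero_iff_of_nonneg fun l _ =>
    Complex.normSq_nonneg (N k l)).1 h3 l (Finset.mem_univ l))

/-- If `b ∈ M_n(A(K))` dominates a nonnegative combination of matrices with positive image under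
`φ`, then the real part of `b` is positive, provided that `φ` is a complete order injection on
`A(K)`. -/
theorem pairing_nonneg_of_sum_le {n : ℕ} (f : ContMatrixAffineMap L K)
    {φ : affineFunctionSpace L →ₗ[ℂ] R.carrier} (hφ : IsUCP (affineFunctions L) R φ)
    (hinj : ∀ (n : ℕ) (b : Matrix (Fin n) (Fin n) (affineFunctionSpace K)),
      R.IsPositive (b.map fun x => φ (f.pullback x)) → (affineFunctions K).IsPositive b)
    {ι : Type*} [Fintype ι] (a : ι → Matrix (Fin n) (Fin n) (affineFunctionSpace L))
    (ha : ∀ i, R.IsPositive ((a i).map φ)) (t : ι → ℝ) (ht : ∀ i, 0 ≤ t i)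
    (b : Matrix (Fin n) (Fin n) (affineFunctionSpace K))
    (hb : ∀ (r : ℕ+) (μ : L.level r) (γ : Matrix (Fin r) (Fin n) ℂ),
      ∑ i, t i * pairing γ ((a i).map (evalHom L μ)) ≤
        pairing γ (b.map (evalHom K (f.toFun r μ))))
    {r : ℕ+} (ν : K.level r) (γ : Matrix (Fin r) (Fin n) ℂ) :
    0 ≤ pairing γ (b.map (evalHom K ν)) := by
  -- Symmetrizing turns the hypothesis on real parts into positivity of this difference.
  let M : Matrix (Fin n) (Fin n) (affineFunctionSpace L) :=
    (symmetrize b).map f.pullback - ∑ i, (t i : ℂ) • symmetrize (a i)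
  have hMapply : ∀ k l, M k l = f.pullback (symmetrize b k l) -
      ∑ i, (t i : ℂ) • symmetrize (a i) k l := fun k l => by
    simp only [M, Matrix.sub_apply, Matrix.map_apply, Matrix.sum_apply, Matrix.smul_apply]
  have hM : (affineFunctions L).IsPositive M := by
    refine (isPositive_affineFunctions_iff _).2 ⟨fun k l => ?_, fun r μ γ => ?_⟩
    · rw [hMapply, hMapply]
      refine ((affineFunctions L).adj_sub _ _).trans (congrArg₂ _ ?_ ?_)
      · exact congrArg f.pullback (adj_symmetrize b k l)
      · refine ((affineFunctions L).adj_sum_real_smul _ _).trans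
          (Finset.sum_congr rfl fun i _ => ?_)
        exact congrArg _ (adj_symmetrize (a i) k l)
    · have h1 : (symmetrize b).map (evalHom K (f.toFun r μ)) = M.map (evalHom L μ) +
          ∑ i, (t i : ℂ) • (symmetrize (a i)).map (evalHom L μ) := by
        refine Matrix.ext fun k l => ?_
        simp only [hMapply, Matrix.add_apply, Matrix.map_apply, Matrix.sum_apply,
          Matrix.smul_apply, map_sub, map_sum, map_smul, sub_add_cancel, evalHom_pullback]
      have h2 := congrArg (pairing γ) h1
      rw [pairing_symmetrize, pairing_add, pairing_sum] at h2
      simp only [pairing_real_smul, pairing_symmetrize, mul_left_comm _ (2 : ℝ),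
        ← Finset.mul_sum] at h2
      have h4 := hb r μ γ
      linarith
  -- The `a i` need not be self-adjoint, but the positive matrix `φ(a i)` is, so symmetrizing `a i`
  -- just doubles its image.
  have hA : ∀ i k l, φ (symmetrize (a i) k l) = φ (a i k l) + φ (a i k l) := fun i k l => by
    refine (map_add φ (a i k l) (affineAdj (a i l k))).trans ?_
    refine congrArg (φ (a i k l) + ·) ((hφ.map_adj _).trans ?_)
    exact Subtype.ext ((ha i).star_apply l k)
  have hB : ((symmetrize b).map fun x => φ (f.pullback x)) =
      M.map φ + ∑ i, (t i : ℂ) • ((a i).map φ + (a i).map φ) := by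
    refine Matrix.ext fun k l => ?_
    simp only [hMapply, hA, Matrix.add_apply, Matrix.map_apply, Matrix.sum_apply,
      Matrix.smul_apply, map_sub, map_sum, map_smul, sub_add_cancel]
  have hBpos := hinj n (symmetrize b) (by
    rw [hB]
    exact (hφ.map_positive n M hM).add (OperatorSystem.isPositive_sum _ _ fun i _ =>
      ((ha i).add (ha i)).real_smul (ht i)))
  have h1 := ((isPositive_affineFunctions_iff _).1 hBpos).2 r ν γ
  rw [pairing_symmetrize] at h1
  linarith

variable [ContinuousAdd V] [ContinuousSMul ℂ V]

theorem isClosed_setOf_pairing_nonneg {n : ℕ+}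
    (a : Matrix (Fin n) (Fin n) (affineFunctionSpace L)) :
    IsClosed {μ : L.level n | 0 ≤ pairing 1 (a.map (evalHom L μ))} := by
  refine isClosed_le continuous_const (Complex.continuous_re.comp ?_)
  refine continuous_finsetSum _ fun k _ => continuous_finsetSum _ fun l _ => ?_
  simp only [sandwich_one, Matrix.map_apply]
  exact (continuous_evalHom (a k l)).matrix_elem k l

/-- The sets `positivitySet φ n` form a compact matrix convex set. -/
def positivityConvexSet (φ : affineFunctionSpace L →ₗ[ℂ] R.carrier) : CompactMatrixConvexSet V where
  level n := Subtype.val '' positivitySet φ n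
  comb_mem n c μ hμ := by
    choose μ' hμ' h using hμ
    obtain rfl : (fun i => (μ' i : Matrix (Fin (c.size i)) (Fin (c.size i)) V)) = μ := funext h
    refine ⟨⟨_, L.comb_mem n c _ fun i => (μ' i).2⟩, fun a ha => ?_, rfl⟩
    have h1 : a.map (evalHom L ⟨_, L.comb_mem n c _ fun i => (μ' i).2⟩) =
        ∑ i, (a.map (evalHom L (μ' i))).map (sandwich (c.coeff i)) :=
      Matrix.ext fun k l => ((a k l).2.affine n c μ').trans (Matrix.sum_apply k l Finset.univ
        fun i => (a.map (evalHom L (μ' i))).map (sandwich (c.coeff i))).symm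
    rw [h1, pairing_sum]
    refine Finset.sum_nonneg fun i _ => ?_
    -- The coefficients need not be square, so positivity at `μ' i` is used for an arbitrary test
    -- matrix.
    rw [← pairing_mul, Matrix.mul_one]
    exact mem_positivitySet_iff.1 (hμ' i) n a ha _
  isCompact_level n := by
    have : CompactSpace (L.level n) := isCompact_iff_compactSpace.1 (L.isCompact_level n)
    refine IsCompact.image (IsClosed.isCompact ?_) continuous_subtype_val
    simp only [positivitySet, Set.ofPred_forall]
    exact isClosed_iInter fun a => isClosed_iInter fun _ => isClosed_setOf_pairing_nonneg a

variable [IsTopologicalAddGroup W] [ContinuousSMul ℂ W] [LocallyConvexSpace ℝ W] [T2Space W]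

/-- If `φ` is unital completely positive on `A(L)` and a complete order injection on `A(K)`, then
every point of `K` lifts to `positivitySet φ`. -/
theorem exists_mem_positivitySet (f : ContMatrixAffineMap L K)
    {φ : affineFunctionSpace L →ₗ[ℂ] R.carrier} (hφ : IsUCP (affineFunctions L) R φ)
    (hinj : ∀ (n : ℕ) (b : Matrix (Fin n) (Fin n) (affineFunctionSpace K)),
      R.IsPositive (b.map fun x => φ (f.pullback x)) → (affineFunctions K).IsPositive b)
    {n : ℕ+} (ν : K.level n) : ∃ μ ∈ positivitySet φ n, f.toFun n μ = ν := by
  classical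
  have : CompactSpace (L.level n) := isCompact_iff_compactSpace.1 (L.isCompact_level n)
  have hcpt : IsCompact {μ : L.level n | f.toFun n μ = ν} :=
    (isClosed_eq (f.continuous_toFun n) continuous_const).isCompact
  -- Finite intersection property on the fibre over `ν`: it suffices to satisfy finitely many
  -- positivity conditions at once.
  obtain ⟨μ, hμ, h⟩ := hcpt.inter_iInter_nonempty
    (fun a : {a : Matrix (Fin n) (Fin n) (affineFunctionSpace L) // R.IsPositive (a.map φ)} =>
      {μ : L.level n | 0 ≤ pairing 1 (a.1.map (evalHom L μ))})
    (fun a => isClosed_setOf_pairing_nonneg a.1) fun s' => by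
      by_contra hempty
      let s := s'.map (Function.Embedding.subtype _)
      have hs : ∀ a : s, R.IsPositive (a.1.map φ) := fun a => by
        obtain ⟨a', -, h⟩ := Finset.mem_map.1 a.2
        rw [← h]
        exact a'.2
      obtain ⟨b, t, ht, hb, hbν⟩ := exists_separating_affineFunction f s ν fun μ hμ => by
        by_contra hall
        push Not at hall
        refine hempty ⟨μ, hμ, Set.mem_iInter₂.2 fun a ha => ?_⟩
        exact hall a.1 (Finset.mem_map_of_mem _ ha)
      exact absurd (pairing_nonneg_of_sum_le f hφ hinj (fun a : s => a.1) hs t ht b hb ν 1)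
        (not_le.2 hbν)
  exact ⟨μ, fun a ha => Set.mem_iInter.1 h ⟨a, ha⟩, hμ⟩

/-- The function systems of a boundary form an essential extension. -/
theorem IsBoundary.isEssentialExtension {G : Type*} [Group G] {L : MatrixAffineSystem G V}
    {K : MatrixAffineSystem G W}
    {f : ContMatrixAffineMap L.toCompactMatrixConvexSet K.toCompactMatrixConvexSet}
    (hequiv : IsEquivariant L K f) (hbd : IsBoundary L K f) :
    IsEssentialExtension (affineFunctionSystem K) (affineFunctionSystem L) f.pullback := by
  refine ⟨hequiv.isEmbedding_pullback hbd.surjective, fun R φ hφ hemb => ?_⟩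
  have huniv : ∀ (n : ℕ+) (μ : L.level n),
      μ ∈ positivitySet (L := L.toCompactMatrixConvexSet) (R := R.toOperatorSystem) φ n := by
    intro n μ
    have h := hbd.minimal (positivityConvexSet (L := L.toCompactMatrixConvexSet)
      (R := R.toOperatorSystem) φ) (fun n => by rintro _ ⟨μ, -, rfl⟩; exact μ.2) ?_ ?_ n
    · obtain ⟨μ', hμ', h1⟩ := h.ge μ.2
      rwa [← Subtype.ext h1]
    · rintro s n μ ⟨μ', hμ', h1⟩
      obtain rfl := Subtype.ext h1
      refine ⟨_, fun a ha => ?_, rfl⟩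
      -- The value of `a` at `h_s(μ')` is that of `a ∘ h_s` at `μ'`, and by equivariance `φ(a ∘
      -- h_s)` is the image of `φ(a)` under the inverse of the action of `s`, hence positive.
      refine hμ' (a.map (L.actMap s).pullback) ?_
      have h2 := (R.act_symm_ucp s).map_positive n _ ha
      have h3 : ∀ x : affineFunctionSpace L.toCompactMatrixConvexSet,
          φ ((L.actMap s).pullback x) = (R.act s).symm (φ x) := fun x => by
        rw [LinearEquiv.eq_symm_apply]
        refine (hφ.equivariant s _).symm.trans (congrArg φ ?_)
        exact (L.actEquiv s).apply_symm_apply x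
      have h4 : (a.map (L.actMap s).pullback).map φ = (a.map φ).map (R.act s).symm :=
        Matrix.ext fun i j => h3 (a i j)
      exact (congrArg R.IsPositive h4).mpr h2
    · intro n ν
      obtain ⟨μ, hμ, h⟩ := exists_mem_positivitySet f hφ.ucp
        (fun n b hb => hemb.reflects_positive n b hb) ν
      exact ⟨μ, ⟨μ, hμ, rfl⟩, h⟩
  have hinj : Function.Injective φ := by
    rw [injective_iff_map_eq_zero]
    intro x hx
    exact eq_zero_of_forall_mem_positivitySet huniv hx
  refine ⟨hφ, hinj, fun m a ha => ?_⟩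
  -- Self-adjointness of `a` is pulled back from that of `φ(a)` by injectivity; the forms are
  -- nonnegative because every point lies in the positivity set.
  refine (isPositive_affineFunctions_iff (K := L.toCompactMatrixConvexSet) a).2
    ⟨fun i j => hinj ?_, fun n μ γ => mem_positivitySet_iff.1 (huniv n μ) m a ha γ⟩
  exact (hφ.ucp.map_adj _).trans (Subtype.ext (ha.star_apply i j))

end Boundary

end NCBoundary

theorem mainTheorem10 {G : Type*} [Group G]
    {V : Type*} [AddCommGroup V] [Module ℂ V] [TopologicalSpace V] [IsTopologicalAddGroup V]
    [ContinuousSMul ℂ V] [LocallyConvexSpace ℝ V] [T2Space V]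
    {W : Type*} [AddCommGroup W] [Module ℂ W] [TopologicalSpace W] [IsTopologicalAddGroup W]
    [ContinuousSMul ℂ W] [LocallyConvexSpace ℝ W] [T2Space W]
    (L : NCBoundary.MatrixAffineSystem G V) (K : NCBoundary.MatrixAffineSystem G W)
    (f : NCBoundary.ContMatrixAffineMap L.toCompactMatrixConvexSet K.toCompactMatrixConvexSet)
    (hsurj : ∀ n, Function.Surjective (f.toFun n))
    (hequiv : NCBoundary.IsEquivariant L K f) :
    NCBoundary.IsBoundary L K f ↔
      NCBoundary.IsEssentialExtension (NCBoundary.affineFunctionSystem K)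
        (NCBoundary.affineFunctionSystem L) f.pullback :=
  ⟨fun h => h.isEssentialExtension hequiv, fun h => h.isBoundary hsurj hequiv⟩
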